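/- Let $d,q\ge 1$, let $U\subseteq\mathbb{R}^d$ be a nonempty open set, let $(\Omega,\mathcal F,\mathbb P)$ be a probability space, and let $\mathbf v\in L^2_{\mathbb P}(\Omega;L^2(U;\mathbb R^q))$ (Bochner space), with mean $\mathbb E[\mathbf v]=\int_\Omega \mathbf v\,d\mathbb P\in L^2(U;\mathbb R^q)$. Then $\mathbf v$ has a version $\mathbf v(\mathbf x,\omega)$ that is measurable with respect to the product measure on $U\times\Omega$ (up to null sets). For every such version, $\mathbf v(\mathbf x,\cdot)\in L^2(\Omega)$ and $\mathbb E[\mathbf v](\mathbf x)=\int_\Omega\mathbf v(\mathbf x,\omega)\,d\mathbb P$ for almost every $\mathbf x\in U$; the matrix-valued covariance function $\mathrm{Cov}(\mathbf v(\mathbf x),\mathbf v(\mathbf y))=[\mathrm{Cov}(v_i(\mathbf x),v_j(\mathbf y))]_{i,j}$ has entries in $L^2(U\times U)$; and the covariance operator $$(\mathcal C_{\mathbf v}\mathbf u)(\mathbf x)=\int_U \mathrm{Cov}(\mathbf v(\mathbf x),\mathbf v(\mathbf y))\,\mathbf u(\mathbf y)\,d\mathbf y$$ maps $L^2(U;\mathbb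 R^q)$ to itself. An eigensystem of $\mathcal C_{\mathbf v}$ is a sequence $\lambda_1\ge\lambda_2\ge\dots\ge 0$ and an orthonormal sequence $(\boldsymbol\phi_k)$ in $L^2(U;\mathbb R^q)$ with $\mathcal C_{\mathbf v}\boldsymbol\phi_k=\lambda_k\boldsymbol\phi_k$ for all $k$, such that every eigenfunction of $\mathcal C_{\mathbf v}$ for a nonzero eigenvalue lies in the closed linear span of $\{\boldsymbol\phi_k\}_k$. An eigensystem exists, and for every eigensystem the following hold, with $Y_k(\omega)=\lambda_k^{-1/2}\int_U(\mathbf v(\mathbf x,\omega)-\mathbb E[\mathbf v](\mathbf x))^{\rm T}\boldsymbol\phi_k(\mathbf x)\,d\mathbf x$ when $\lambda_k>0$ (and $Y_k=0$ when $\lambda_k=0$). 1. $\sum_k\lambda_k<\infty$ and $Y_k\in L^2_{\mathbb P}(\Omega)$ for all $k$; moreover $\mathbb E[Y_k]=0$ and $\mathbb E[Y_kY_l]=\delta_{kl}$ for all $k,l$ with $\lambda_k,\lambda_l>0$. 2. $\mathbf v=\mathbb E[\mathbf v]+\sum_k\lambda_k^{1/2}\boldsymbol\phi_kY_k$, with unconditional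 convergence in $L^2_{\mathbb P}(\Omega;L^2(U;\mathbb R^q))$. 3. Let $\mathbf w=\mathbf v-\mathbb E[\mathbf v]$ and $M\ge 0$. For a finite-dimensional subspace $H\subset L^2(U;\mathbb R^q)$ let $P_{H\otimes L^2_{\mathbb P}(\Omega)}$ be the orthogonal projection of $L^2_{\mathbb P}(\Omega;L^2(U;\mathbb R^q))$ onto the closed span of the elements $\omega\mapsto s(\omega)\boldsymbol\phi$ with $\boldsymbol\phi\in H$, $s\in L^2_{\mathbb P}(\Omega)$. Then $$\min_{\dim H=M}\bigl\|\mathbf w-P_{H\otimes L^2_{\mathbb P}(\Omega)}\mathbf w\bigr\|_{L^2_{\mathbb P}(\Omega;L^2(U;\mathbb R^q))}=\Bigl(\sum_{k\ge M+1}\lambda_k\Bigr)^{1/2},$$ and the minimum is attained at $H=\mathrm{span}\{\boldsymbol\phi_1,\dots,\boldsymbol\phi_M\}$. A subspace $H$ of dimension $M$ attains it if and only if $H$ has an orthonormal basis $\psi_1,\dots,\psi_M$ with $\mathcal C_{\mathbf v}\psi_i=\lambda_i\psi_i$ for all $i\le M$. If $\lambda_{M+1}<\lambda_i$ for all $i\le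 M$, it is attained only at $H=\mathrm{span}\{\boldsymbol\phi_1,\dots,\boldsymbol\phi_M\}$. -/

import Mathlib

open MeasureTheory ProbabilityTheory Filter Topology

noncomputable section

/-- The Hilbert space `L²(U; ℝ^q)` for `U ⊆ ℝ^d` with Lebesgue measure. -/
abbrev L2Field {d : ℕ} (U : Set (EuclideanSpace ℝ (Fin d))) (q : ℕ) : Type :=
  Lp (EuclideanSpace ℝ (Fin q)) 2 (volume.restrict U)

variable {d q : ℕ} {Ω : Type*} [MeasurableSpace Ω]

/-- The Bochner space `L²_P(Ω; L²(U; ℝ^q))` of square-integrable random vector fields. -/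
abbrev RandomField (P : Measure Ω) (U : Set (EuclideanSpace ℝ (Fin d))) (q : ℕ) : Type _ :=
  Lp (L2Field U q) 2 P

/-- The mean field `E[v]`, an element of `L²(U; ℝ^q)`. -/
def meanField {P : Measure Ω} {U : Set (EuclideanSpace ℝ (Fin d))}
    (v : RandomField P U q) : L2Field U q :=
  ∫ ω, v ω ∂P

/-- `V` is a version `v(x, ω)` of the random field `v`, jointly measurable in `(x, ω)` up to
null sets: for almost every `ω`, the function `x ↦ V x ω` represents the class `v ω`. -/
structure IsPointwiseVersion {P : Measure Ω} {U : Set (EuclideanSpace ℝ (Fin d))}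
    (v : RandomField P U q) (V : EuclideanSpace ℝ (Fin d) → Ω → EuclideanSpace ℝ (Fin q)) :
    Prop where
  aestronglyMeasurable : AEStronglyMeasurable (Function.uncurry V) ((volume.restrict U).prod P)
  ae_eq : ∀ᵐ ω ∂P, (fun x => V x ω) =ᵐ[volume.restrict U] v ω

/-- The matrix-valued covariance function, with entries `Cov(v_i(x), v_j(y))`. -/
def covMatrix (P : Measure Ω) (V : EuclideanSpace ℝ (Fin d) → Ω → EuclideanSpace ℝ (Fin q))
    (x y : EuclideanSpace ℝ (Fin d)) : Matrix (Fin q) (Fin q) ℝ :=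
  Matrix.of fun i j => cov[fun ω => V x ω i, fun ω => V y ω j; P]

/-- The covariance operator `(C u)(x) = ∫_U Cov(v(x), v(y)) u(y) dy`. -/
def covOp (P : Measure Ω) (U : Set (EuclideanSpace ℝ (Fin d)))
    (V : EuclideanSpace ℝ (Fin d) → Ω → EuclideanSpace ℝ (Fin q))
    (u : EuclideanSpace ℝ (Fin d) → EuclideanSpace ℝ (Fin q))
    (x : EuclideanSpace ℝ (Fin d)) : EuclideanSpace ℝ (Fin q) :=
  ∫ y in U, WithLp.toLp 2 (Matrix.mulVec (covMatrix P V x y) (u y))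

/-- `u ∈ L²(U; ℝ^q)` satisfies `C u = μ u` (almost everywhere on `U`). -/
def CovEigen (P : Measure Ω) {U : Set (EuclideanSpace ℝ (Fin d))}
    (V : EuclideanSpace ℝ (Fin d) → Ω → EuclideanSpace ℝ (Fin q))
    (μ : ℝ) (u : L2Field U q) : Prop :=
  covOp P U V u =ᵐ[volume.restrict U] fun x => μ • u x

/-- `(lam k, φ k)`, `k = 0, 1, …`, is an enumeration of the eigenpairs of the covariance operator:
the eigenvalues are nonnegative and nonincreasing, the eigenfunctions are orthonormal, and no
nonzero eigenvalue or eigenfunction is left out. -/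
structure IsCovEigensystem (P : Measure Ω) {U : Set (EuclideanSpace ℝ (Fin d))}
    (V : EuclideanSpace ℝ (Fin d) → Ω → EuclideanSpace ℝ (Fin q))
    (lam : ℕ → ℝ) (φ : ℕ → L2Field U q) : Prop where
  nonneg : ∀ k, 0 ≤ lam k
  antitone : Antitone lam
  orthonormal : Orthonormal ℝ φ
  eigen : ∀ k, CovEigen P V (lam k) (φ k)
  exhaustive : ∀ (μ : ℝ) (u : L2Field U q), μ ≠ 0 → CovEigen P V μ u →
    u ∈ (Submodule.span ℝ (Set.range φ)).topologicalClosure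

/-- The coefficient `Y(ω) = lam^(-1/2) ∫_U (v(x, ω) - E[v](x))ᵀ φ(x) dx`. -/
def klCoeff {P : Measure Ω} {U : Set (EuclideanSpace ℝ (Fin d))}
    (v : RandomField P U q) (lam : ℝ) (φ : L2Field U q) (ω : Ω) : ℝ :=
  (Real.sqrt lam)⁻¹ * ∫ x in U, inner ℝ (v ω x - meanField v x) (φ x)

/-- The elementary tensor `φ ⊗ s`, i.e. `ω ↦ s(ω) φ`, in `L²_P(Ω; L²(U; ℝ^q))`. -/
def elemTensor {P : Measure Ω} {U : Set (EuclideanSpace ℝ (Fin d))}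
    (φ : L2Field U q) (s : Lp ℝ 2 P) : RandomField P U q :=
  (ContinuousLinearMap.toSpanSingleton ℝ φ).compLp s

/-- The Hilbert tensor product `H ⊗ L²_P(Ω)` as a closed subspace of `L²_P(Ω; L²(U; ℝ^q))`. -/
def tensorSubspace (P : Measure Ω) {U : Set (EuclideanSpace ℝ (Fin d))}
    (H : Submodule ℝ (L2Field U q)) : Submodule ℝ (RandomField P U q) :=
  (Submodule.span ℝ {w | ∃ φ ∈ H, ∃ s : Lp ℝ 2 P, w = elemTensor φ s}).topologicalClosure

instance (P : Measure Ω) {U : Set (EuclideanSpace ℝ (Fin d))}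
    (H : Submodule ℝ (L2Field U q)) : CompleteSpace (tensorSubspace P H) :=
  (Submodule.isClosed_topologicalClosure _).completeSpace_coe

/-- The error `‖w - P_{H ⊗ L²_P(Ω)} w‖` in `L²_P(Ω; L²(U; ℝ^q))`. -/
def projError {P : Measure Ω} {U : Set (EuclideanSpace ℝ (Fin d))}
    (w : RandomField P U q) (H : Submodule ℝ (L2Field U q)) : ℝ :=
  ‖w - (tensorSubspace P H).starProjection w‖

end

/-! Write `w = v - E[v]`. The operator `A a = ⟪a, w⟫` from `L²(U; ℝ^q)` to `L²(Ω)` is compact,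
being a limit of finite rank operators when `w` is approximated by simple functions, and by Fubini's
theorem the covariance operator is `C = A* A`. Hence `C` is compact and positive, and maximizing its
quadratic form successively over the orthogonal complements of the eigenvectors already found
produces an eigensystem, `L²(U; ℝ^q)` being infinite dimensional. For any eigensystem, `C`, and with
it `A`, vanishes on the orthogonal complement of the `φ k`; so `w` takes values in their closed span
almost surely, and integrating Parseval's identity gives `‖w‖² = ∑ ‖A (φ k)‖² = ∑ lam k`, from which
the expansion follows.

The projection onto `H ⊗ L²(Ω)` applies the projection onto `H` pointwise, so the squared error is
`‖w‖²` minus the trace of `C` compressed to `H`. By Courant–Fischer, the eigenvalues of the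
compression are dominated one by one by the `lam k`. If the traces agree, then so do these
eigenvalues, and each eigenvector of the compression in turn maximizes the quadratic form of `C`
over the complement of the previous ones, which makes it an eigenvector of `C`. -/

section OrthonormalSequences

variable {E : Type*} [NormedAddCommGroup E] [InnerProductSpace ℝ E]

theorem mem_orthogonal_span_iff {s : Set E} {x : E} :
    x ∈ (Submodule.span ℝ s)ᗮ ↔ ∀ y ∈ s, inner ℝ y x = 0 := by
  rw [← Submodule.span_singleton_le_iff_mem, ← Submodule.isOrtho_iff_le, Submodule.isOrtho_comm,
    Submodule.isOrtho_span]
  simp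

theorem exists_ne_zero_mem_forall_inner_eq_zero {V : Submodule ℝ E} {n : ℕ}
    (hn : n < Module.finrank ℝ V) (u : Fin n → E) :
    ∃ x ∈ V, x ≠ 0 ∧ ∀ k, inner ℝ (u k) x = 0 := by
  have : FiniteDimensional ℝ V := Module.finite_of_finrank_pos (Nat.zero_lt_of_lt hn)
  let f : V →ₗ[ℝ] Fin n → ℝ := LinearMap.pi fun k => (innerₗ E (u k)).domRestrict V
  have hf : LinearMap.ker f ≠ ⊥ := f.ker_ne_bot_of_finrank_lt (by simpa using hn)
  obtain ⟨x, hx, hx0⟩ := (Submodule.ne_bot_iff _).1 hf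
  exact ⟨x, x.2, by simpa using hx0, fun k => congrFun hx k⟩

theorem coe_orthonormal {ι : Type*} [Fintype ι] {H : Submodule ℝ E}
    (b : OrthonormalBasis ι ℝ H) : Orthonormal ℝ fun i => (b i : E) :=
  b.orthonormal.comp_linearIsometry H.subtypeₗᵢ

theorem span_range_coe_eq {ι : Type*} [Fintype ι] {H : Submodule ℝ E}
    (b : OrthonormalBasis ι ℝ H) : Submodule.span ℝ (Set.range fun i => (b i : E)) = H := by
  have h := congrArg (Submodule.map H.subtype) b.toBasis.span_eq
  rw [Submodule.map_span, Submodule.map_top, Submodule.range_subtype, ← Set.range_comp] at h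
  simpa [Function.comp_def] using! h

theorem exists_orthonormalBasis_coe_eq {ι : Type*} [Fintype ι] {v : ι → E}
    (hv : Orthonormal ℝ v) :
    ∃ b : OrthonormalBasis ι ℝ (Submodule.span ℝ (Set.range v)), ∀ i, (b i : E) = v i := by
  have htop : ⊤ ≤ Submodule.span ℝ (Set.range fun i =>
      (⟨v i, Submodule.subset_span ⟨i, rfl⟩⟩ : Submodule.span ℝ (Set.range v))) := by
    convert! (Module.Basis.span hv.linearIndependent).span_eq.ge
    exact congrArg Subtype.val (Module.Basis.span_apply hv.linearIndependent _).symm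
  exact ⟨.mk (orthonormal_span hv) htop, fun i => by rw [OrthonormalBasis.coe_mk]⟩

theorem image_Iio_eq_range {α : Type*} (u : ℕ → α) (n : ℕ) :
    u '' Set.Iio n = Set.range fun i : Fin n => u i := by
  ext; simp [Fin.exists_iff]

theorem hasSum_inner_smul_of_mem_topologicalClosure_span [CompleteSpace E] {ι : Type*} {φ : ι → E}
    (hφ : Orthonormal ℝ φ) {x : E}
    (hx : x ∈ (Submodule.span ℝ (Set.range φ)).topologicalClosure) :
    HasSum (fun k => inner ℝ (φ k) x • φ k) x := by
  let K := (Submodule.span ℝ (Set.range φ)).topologicalClosure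
  have : CompleteSpace K := (Submodule.isClosed_topologicalClosure _).completeSpace_coe
  let v : ι → K := fun k =>
    ⟨φ k, Submodule.le_topologicalClosure _ (Submodule.subset_span ⟨k, rfl⟩)⟩
  have hv : Orthonormal ℝ v := ⟨hφ.1, fun _ _ hij => hφ.2 hij⟩
  have htotal : (Submodule.span ℝ (Set.range v))ᗮ = ⊥ := by
    refine (Submodule.eq_bot_iff _).2 fun y hy => Subtype.ext ((inner_self_eq_zero (𝕜 := ℝ)).1 ?_)
    have hyK : (y : E) ∈ Kᗮ := by
      rw [Submodule.orthogonal_closure, mem_orthogonal_span_iff, Set.forall_mem_range]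
      exact Set.forall_mem_range.1 (mem_orthogonal_span_iff.1 hy)
    exact hyK y y.2
  have h := ((HilbertBasis.mkOfOrthogonalEqBot hv htotal).hasSum_repr ⟨x, hx⟩).mapL K.subtypeL
  simpa only [HilbertBasis.repr_apply_apply, HilbertBasis.coe_mkOfOrthogonalEqBot] using! h

theorem hasSum_inner_sq_of_mem_topologicalClosure_span [CompleteSpace E] {ι : Type*} {φ : ι → E}
    (hφ : Orthonormal ℝ φ) {x : E}
    (hx : x ∈ (Submodule.span ℝ (Set.range φ)).topologicalClosure) :
    HasSum (fun k => inner ℝ (φ k) x ^ 2) (‖x‖ ^ 2) := by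
  have h := (hasSum_inner_smul_of_mem_topologicalClosure_span hφ hx).mapL (innerSL ℝ x)
  simpa only [innerSL_apply_apply, real_inner_smul_right, real_inner_comm x, ← sq,
    real_inner_self_eq_norm_sq] using h

end OrthonormalSequences

section SpectralTheory

variable {E : Type*} [NormedAddCommGroup E] [InnerProductSpace ℝ E] {T : E →L[ℝ] E}

theorem apply_mem_orthogonal_span_of_eigenvectors {T : E →ₗ[ℝ] E} (hT : T.IsSymmetric) {s : Set E}
    (hs : ∀ x ∈ s, ∃ μ : ℝ, T x = μ • x) {z : E} (hz : z ∈ (Submodule.span ℝ s)ᗮ) :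
    T z ∈ (Submodule.span ℝ s)ᗮ := by
  rw [mem_orthogonal_span_iff] at hz ⊢
  intro x hx
  obtain ⟨μ, hμ⟩ := hs x hx
  rw [← hT, hμ, real_inner_smul_left, hz x hx, mul_zero]

theorem inner_eq_zero_of_eigenvalue_ne {T : E →ₗ[ℝ] E} (hT : T.IsSymmetric) {μ ν : ℝ} {x y : E}
    (hx : T x = μ • x) (hy : T y = ν • y) (h : μ ≠ ν) : inner ℝ x y = 0 :=
  hT.orthogonalFamily_eigenspaces h ⟨x, Module.End.mem_eigenspace_iff.2 hx⟩
    ⟨y, Module.End.mem_eigenspace_iff.2 hy⟩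

theorem mem_topologicalClosure_of_eigenvector [CompleteSpace E] {T : E →ₗ[ℝ] E}
    (hT : T.IsSymmetric) {K : Submodule ℝ E} (hK : ∀ x ∈ Kᗮ, T x = 0) {μ : ℝ} (hμ : μ ≠ 0) {u : E}
    (hu : T u = μ • u) : u ∈ K.topologicalClosure := by
  rw [← Submodule.orthogonal_orthogonal_eq_closure]
  intro x hx
  have h := hT x u
  rw [hK x hx, hu, inner_zero_left, real_inner_smul_right] at h
  exact (mul_eq_zero.1 h.symm).resolve_left hμ

theorem apply_eq_zero_of_inner_apply_self_eq_zero {T : E →ₗ[ℝ] E} (hT : T.IsPositive) {x : E}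
    (hx : inner ℝ (T x) x = 0) : T x = 0 := by
  have hquad : ∀ t : ℝ, 0 ≤ inner ℝ (T (T x)) (T x) * (t * t) + 2 * ‖T x‖ ^ 2 * t + 0 := fun t => by
    have h := hT.inner_nonneg_left (x + t • T x)
    have hsymm := hT.isSymmetric (T x) x
    simp only [map_add, map_smul, inner_add_left, inner_add_right, real_inner_smul_left,
      real_inner_smul_right, hx, hsymm, real_inner_self_eq_norm_sq] at h
    linarith
  have h := discrim_le_zero hquad
  simpa [discrim, sq_nonpos_iff] using h

theorem apply_eq_smul_of_isMax {T : E →ₗ[ℝ] E} (hT : T.IsSymmetric) {K : Submodule ℝ E}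
    (hinv : ∀ x ∈ K, T x ∈ K) {μ : ℝ} (hle : ∀ z ∈ K, inner ℝ (T z) z ≤ μ * ‖z‖ ^ 2) {x : E}
    (hx : x ∈ K) (hxμ : inner ℝ (T x) x = μ * ‖x‖ ^ 2) : T x = μ • x := by
  let S : K →ₗ[ℝ] K := μ • LinearMap.id - T.restrict hinv
  have hinner : ∀ z : K, inner ℝ (S z) z = μ * ‖(z : E)‖ ^ 2 - inner ℝ (T z) z := fun z => by
    rw [← real_inner_self_eq_norm_sq, ← real_inner_smul_left, ← inner_sub_left]; rfl
  have hS : S.IsPositive :=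
    ⟨(LinearMap.IsSymmetric.id.smul rfl).sub (hT.restrict_invariant hinv), fun z => by
      simpa [hinner] using hle z z.2⟩
  have h := apply_eq_zero_of_inner_apply_self_eq_zero hS (x := ⟨x, hx⟩) (by simp [hinner, hxμ])
  exact (sub_eq_zero.1 (congrArg Subtype.val h)).symm

section Compact

theorem tendsto_apply_zero_of_orthonormal {F : Type*} [NormedAddCommGroup F]
    [InnerProductSpace ℝ F] [CompleteSpace E] [CompleteSpace F] {T : E →L[ℝ] F}
    (hc : IsCompactOperator T) {ι : Type*} {φ : ι → E} (hφ : Orthonormal ℝ φ) :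
    Tendsto (fun k => T (φ k)) cofinite (𝓝 0) := by
  obtain ⟨K, hK, hKT⟩ := hc.image_closedBall_subset_compact (f := T.toLinearMap) 1
  refine hK.tendsto_nhds_of_unique_mapClusterPt
    (Eventually.of_forall fun k => hKT ⟨φ k, by simp [hφ.1 k], rfl⟩) fun y _ hy => ?_
  have hweak : Tendsto (fun k => inner ℝ y (T (φ k))) cofinite (𝓝 0) := by
    have h := (hφ.inner_products_summable (T.adjoint y)).tendsto_cofinite_zero.sqrt
    rw [tendsto_zero_iff_norm_tendsto_zero]
    simpa [Real.sqrt_sq_eq_abs, ← T.adjoint_inner_left, real_inner_comm] using h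
  have hcl : MapClusterPt (inner ℝ y y) cofinite fun k => inner ℝ y (T (φ k)) :=
    hy.continuousAt_comp (by fun_prop)
  exact inner_self_eq_zero.1 (eq_of_nhds_neBot (hcl.clusterPt.mono hweak).neBot)

open Module.End in
theorem exists_norm_eq_one_apply_eq_norm_smul [CompleteSpace E] [Nontrivial E]
    (hT : T.IsPositive) (hc : IsCompactOperator T) : ∃ x : E, ‖x‖ = 1 ∧ T x = ‖T‖ • x := by
  suffices h : ∃ x : E, x ≠ 0 ∧ T x = ‖T‖ • x by
    obtain ⟨x, hx, hTx⟩ := h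
    refine ⟨‖x‖⁻¹ • x, by simp [norm_smul, hx], ?_⟩
    rw [map_smul, hTx, smul_comm]
  by_cases h0 : ‖T‖ = 0
  · obtain ⟨x, hx⟩ := exists_ne (0 : E)
    exact ⟨x, hx, by simp [norm_eq_zero.1 h0]⟩
  rcases hc.hasEigenvalue_or_mem_resolventSet h0 with h | h
  · obtain ⟨x, hx⟩ := h.exists_hasEigenvector
    exact ⟨x, hx.2, hx.apply_eq_smul⟩
  · obtain ⟨ε, hε, hle⟩ := T.rayleighQuotient_le_of_norm_mem_resolventSet (by simpa using h)
    have hrayleigh : ∀ x, 0 ≤ T.rayleighQuotient x := fun x =>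
      div_nonneg (by simpa using! hT.inner_nonneg_left x) (by positivity)
    have hsup : ⨆ x, |T.rayleighQuotient x| ≤ ‖T‖ - ε :=
      ciSup_le fun x => (abs_of_nonneg (hrayleigh x)).trans_le (hle x)
    linarith [T.norm_eq_iSup_rayleighQuotient hT.isSymmetric]

/-- `x` is a unit eigenvector of `T` in `K`, with eigenvalue `μ`, at which the quadratic form
`⟪T z, z⟫ / ‖z‖ ^ 2` attains its maximum over `K`. -/
structure IsMaximalEigenvector (T : E →L[ℝ] E) (K : Submodule ℝ E) (μ : ℝ) (x : E) : Prop where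
  mem : x ∈ K
  norm_eq_one : ‖x‖ = 1
  apply_eq : T x = μ • x
  inner_apply_le : ∀ z ∈ K, inner ℝ (T z) z ≤ μ * ‖z‖ ^ 2

theorem exists_isMaximalEigenvector (hT : T.IsPositive) (hc : IsCompactOperator T)
    {K : Submodule ℝ E} [CompleteSpace K] (hK : K ≠ ⊥) (hinv : ∀ x ∈ K, T x ∈ K) :
    ∃ μ x, IsMaximalEigenvector T K μ x := by
  have : Nontrivial K := Submodule.nontrivial_iff_ne_bot.2 hK
  let S : K →L[ℝ] K := T.restrict hinv
  have hS : S.IsPositive := (ContinuousLinearMap.isPositive_iff' S).2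
    ⟨ContinuousLinearMap.isSelfAdjoint_iff_isSymmetric.2 (hT.isSymmetric.restrict_invariant hinv),
      fun x => by simpa using! hT.inner_nonneg_left (x : E)⟩
  obtain ⟨x, hx, hSx⟩ := exists_norm_eq_one_apply_eq_norm_smul hS (hc.restrict' hinv)
  refine ⟨‖S‖, x, x.2, hx, congrArg Subtype.val hSx, fun z hz => ?_⟩
  calc inner ℝ (T z) z = inner ℝ (S ⟨z, hz⟩) ⟨z, hz⟩ := rfl
    _ ≤ ‖S ⟨z, hz⟩‖ * ‖(⟨z, hz⟩ : K)‖ := real_inner_le_norm _ _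
    _ ≤ (‖S‖ * ‖(⟨z, hz⟩ : K)‖) * ‖(⟨z, hz⟩ : K)‖ := by gcongr; exact S.le_opNorm _
    _ = ‖S‖ * ‖z‖ ^ 2 := by simp only [Submodule.coe_norm]; ring

end Compact

end SpectralTheory

section Eigensystems

variable {E : Type*} [NormedAddCommGroup E] [InnerProductSpace ℝ E] {T : E →L[ℝ] E}

/-- `(lam k, φ k)`, `k = 0, 1, …`, enumerates the eigenpairs of `T`: the eigenvalues are
nonnegative and nonincreasing, the eigenvectors are orthonormal, and their closed span contains
every eigenvector for a nonzero eigenvalue. -/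
structure IsEigensystem (T : E →L[ℝ] E) (lam : ℕ → ℝ) (φ : ℕ → E) : Prop where
  nonneg : ∀ k, 0 ≤ lam k
  antitone : Antitone lam
  orthonormal : Orthonormal ℝ φ
  apply_eq : ∀ k, T (φ k) = lam k • φ k
  exhaustive : ∀ (μ : ℝ) (u : E), μ ≠ 0 → T u = μ • u →
    u ∈ (Submodule.span ℝ (Set.range φ)).topologicalClosure

variable [CompleteSpace E] {lam : ℕ → ℝ} {φ : ℕ → E}

theorem tendsto_eigenvalues_zero (hc : IsCompactOperator T) (hφ : Orthonormal ℝ φ)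
    (heig : ∀ k, T (φ k) = lam k • φ k) : Tendsto lam atTop (𝓝 0) := by
  have h := (tendsto_apply_zero_of_orthonormal hc hφ).norm
  rw [Nat.cofinite_eq_atTop] at h
  rw [tendsto_zero_iff_norm_tendsto_zero]
  simpa [heig, norm_smul, hφ.1] using h

omit [CompleteSpace E] in
theorem apply_eq_zero_of_forall_inner_apply_le (hT : T.IsPositive) (hlam : Tendsto lam atTop (𝓝 0))
    {x : E} (hx : ∀ n, inner ℝ (T x) x ≤ lam n * ‖x‖ ^ 2) : T x = 0 := by
  have hle : inner ℝ (T x) x ≤ 0 := by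
    simpa using! ge_of_tendsto' (hlam.mul_const (‖x‖ ^ 2)) hx
  exact apply_eq_zero_of_inner_apply_self_eq_zero hT.toLinearMap
    (hle.antisymm (hT.inner_nonneg_left x))

theorem exists_seq_isMaximalEigenvector (hT : T.IsPositive) (hc : IsCompactOperator T)
    (hE : ¬ FiniteDimensional ℝ E) :
    ∃ (lam : ℕ → ℝ) (φ : ℕ → E),
      ∀ n, IsMaximalEigenvector T (Submodule.span ℝ (φ '' Set.Iio n))ᗮ (lam n) (φ n) := by
  have hstep : ∀ s : Set E, s.Finite → ∃ x, (∀ y ∈ s, ∃ μ : ℝ, T y = μ • y) →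
      ∃ μ, IsMaximalEigenvector T (Submodule.span ℝ s)ᗮ μ x := by
    intro s hs
    by_cases heig : ∀ y ∈ s, ∃ μ : ℝ, T y = μ • y
    · have : FiniteDimensional ℝ (Submodule.span ℝ s) := FiniteDimensional.span_of_finite ℝ hs
      have hne : (Submodule.span ℝ s)ᗮ ≠ ⊥ := fun h => hE <| by
        rw [Submodule.orthogonal_eq_bot_iff] at h
        exact Module.finite_def.2 (h ▸ Submodule.fg_span hs)
      obtain ⟨μ, x, hx⟩ := exists_isMaximalEigenvector hT hc hne
        fun z hz => apply_mem_orthogonal_span_of_eigenvectors hT.isSymmetric heig hz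
      exact ⟨x, fun _ => ⟨μ, hx⟩⟩
    · exact ⟨0, fun h => absurd h heig⟩
  obtain ⟨φ, hφ⟩ := Set.seq_of_forall_finite_exists (P := fun x s =>
    (∀ y ∈ s, ∃ μ : ℝ, T y = μ • y) → ∃ μ, IsMaximalEigenvector T (Submodule.span ℝ s)ᗮ μ x) hstep
  have hmax : ∀ n, ∃ μ, IsMaximalEigenvector T (Submodule.span ℝ (φ '' Set.Iio n))ᗮ μ (φ n) := by
    intro n
    induction n using Nat.strong_induction_on with
    | _ n ih =>
      refine hφ n ?_
      rintro _ ⟨k, hk, rfl⟩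
      obtain ⟨μ, hμ⟩ := ih k hk
      exact ⟨μ, hμ.apply_eq⟩
  choose lam hlam using hmax
  exact ⟨lam, φ, hlam⟩

theorem isEigensystem_of_forall_isMaximalEigenvector (hT : T.IsPositive) (hc : IsCompactOperator T)
    (h : ∀ n, IsMaximalEigenvector T (Submodule.span ℝ (φ '' Set.Iio n))ᗮ (lam n) (φ n)) :
    IsEigensystem T lam φ := by
  have hon : Orthonormal ℝ φ := by
    have hlt : ∀ m n, m < n → inner ℝ (φ m) (φ n) = 0 := fun m n hmn =>
      (h n).mem _ (Submodule.subset_span ⟨m, hmn, rfl⟩)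
    refine ⟨fun n => (h n).norm_eq_one, fun m n hmn => ?_⟩
    rcases hmn.lt_or_gt with hmn | hmn
    · exact hlt m n hmn
    · rw [real_inner_comm, hlt n m hmn]
  have hquad : ∀ n, inner ℝ (T (φ n)) (φ n) = lam n := fun n => by
    rw [(h n).apply_eq, real_inner_smul_left, real_inner_self_eq_norm_sq, hon.1, one_pow, mul_one]
  refine ⟨fun n => hquad n ▸ hT.inner_nonneg_left _, antitone_nat_of_succ_le fun n => ?_, hon,
    fun n => (h n).apply_eq, fun μ u hμ hu => ?_⟩
  · have hmem : φ (n + 1) ∈ (Submodule.span ℝ (φ '' Set.Iio n))ᗮ := Submodule.orthogonal_le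
      (Submodule.span_mono (Set.image_mono (Set.Iio_subset_Iio n.le_succ))) (h (n + 1)).mem
    simpa [hquad, hon.1] using (h n).inner_apply_le _ hmem
  · refine mem_topologicalClosure_of_eigenvector hT.isSymmetric (fun x hx => ?_) hμ hu
    exact apply_eq_zero_of_forall_inner_apply_le hT
      (tendsto_eigenvalues_zero hc hon fun n => (h n).apply_eq) fun n => (h n).inner_apply_le x <|
        Submodule.orthogonal_le (Submodule.span_mono (Set.image_subset_range _ _)) hx

theorem exists_isEigensystem (hT : T.IsPositive) (hc : IsCompactOperator T)
    (hE : ¬ FiniteDimensional ℝ E) : ∃ lam φ, IsEigensystem T lam φ := by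
  obtain ⟨lam, φ, h⟩ := exists_seq_isMaximalEigenvector hT hc hE
  exact ⟨lam, φ, isEigensystem_of_forall_isMaximalEigenvector hT hc h⟩

namespace IsEigensystem

variable (h : IsEigensystem T lam φ) (hT : T.IsPositive) (hc : IsCompactOperator T)
include h hT

theorem span_eq_of_lt {M : ℕ} (hgap : ∀ i < M, lam M < lam i) {ψ : Fin M → E}
    (hψ : Orthonormal ℝ ψ) (hTψ : ∀ i : Fin M, T (ψ i) = lam i • ψ i) :
    Submodule.span ℝ (Set.range ψ) = Submodule.span ℝ (φ '' Set.Iio M) := by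
  have hφM : Orthonormal ℝ fun i : Fin M => φ i := h.orthonormal.comp _ Fin.val_injective
  have : FiniteDimensional ℝ (Submodule.span ℝ (φ '' Set.Iio M)) :=
    FiniteDimensional.span_of_finite ℝ ((Set.finite_Iio M).image φ)
  refine Submodule.eq_of_le_of_finrank_eq (Submodule.span_le.2 ?_) ?_
  · rintro _ ⟨i, rfl⟩
    have hi := hgap i i.2
    have hsum := hasSum_inner_smul_of_mem_topologicalClosure_span h.orthonormal
      (h.exhaustive (lam i) (ψ i) ((h.nonneg M).trans_lt hi).ne' (hTψ i))
    have hzero : ∀ k ∉ Finset.range M, inner ℝ (φ k) (ψ i) • φ k = 0 := fun k hk => by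
      have hlt : lam k < lam i := (h.antitone (by simpa using hk)).trans_lt hi
      rw [inner_eq_zero_of_eigenvalue_ne hT.isSymmetric (h.apply_eq k) (hTψ i) hlt.ne, zero_smul]
    rw [hsum.unique (hasSum_sum_of_ne_finset_zero hzero)]
    exact Submodule.sum_mem _ fun k hk => Submodule.smul_mem _ _
      (Submodule.subset_span ⟨k, by simpa using hk, rfl⟩)
  · rw [image_Iio_eq_range, finrank_span_eq_card hψ.linearIndependent,
      finrank_span_eq_card hφM.linearIndependent]

theorem eigenvalue_le_of_forall_inner_eq_zero {i : ℕ} {μ : ℝ} {y : E} (hy : y ≠ 0)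
    (hTy : T y = μ • y) (hyφ : ∀ k < i, inner ℝ (φ k) y = 0) : μ ≤ lam i := by
  by_contra! hμ
  have hperp : ∀ k, inner ℝ (φ k) y = 0 := fun k => by
    rcases lt_or_ge k i with hk | hk
    · exact hyφ k hk
    · exact inner_eq_zero_of_eigenvalue_ne hT.isSymmetric (h.apply_eq k) hTy
        ((h.antitone hk).trans_lt hμ).ne
  have hsum := hasSum_inner_sq_of_mem_topologicalClosure_span h.orthonormal
    (h.exhaustive μ y ((h.nonneg i).trans_lt hμ).ne' hTy)
  simp only [hperp, ne_eq, OfNat.ofNat_ne_zero, not_false_eq_true, zero_pow] at hsum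
  exact hy (by simpa using hsum.unique hasSum_zero)

include hc

theorem inner_apply_le {i : ℕ} {x : E} (hx : ∀ k < i, inner ℝ (φ k) x = 0) :
    inner ℝ (T x) x ≤ lam i * ‖x‖ ^ 2 := by
  have hxK : x ∈ (Submodule.span ℝ (φ '' Set.Iio i))ᗮ :=
    mem_orthogonal_span_iff.2 (Set.forall_mem_image.2 fun k hk => hx k hk)
  have hinv : ∀ z ∈ (Submodule.span ℝ (φ '' Set.Iio i))ᗮ,
      T z ∈ (Submodule.span ℝ (φ '' Set.Iio i))ᗮ := fun z hz =>
    apply_mem_orthogonal_span_of_eigenvectors hT.isSymmetric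
      (Set.forall_mem_image.2 fun k _ => ⟨lam k, h.apply_eq k⟩) hz
  rcases eq_or_ne (Submodule.span ℝ (φ '' Set.Iio i))ᗮ ⊥ with hK | hK
  · rw [(Submodule.eq_bot_iff _).1 hK x hxK]
    simp
  obtain ⟨μ, y, hy⟩ := exists_isMaximalEigenvector hT hc hK hinv
  refine (hy.inner_apply_le x hxK).trans (mul_le_mul_of_nonneg_right ?_ (sq_nonneg _))
  exact h.eigenvalue_le_of_forall_inner_eq_zero hT (norm_ne_zero_iff.1 (by simp [hy.norm_eq_one]))
    hy.apply_eq fun k hk => hy.mem _ (Submodule.subset_span ⟨k, hk, rfl⟩)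

theorem apply_eq_zero {x : E} (hx : x ∈ (Submodule.span ℝ (Set.range φ))ᗮ) : T x = 0 :=
  apply_eq_zero_of_forall_inner_apply_le hT (tendsto_eigenvalues_zero hc h.orthonormal h.apply_eq)
    fun _ => h.inner_apply_le hT hc fun k _ => hx _ (Submodule.subset_span ⟨k, rfl⟩)

theorem le_eigenvalue_of_lt_finrank {V : Submodule ℝ E} {i : ℕ} (hi : i < Module.finrank ℝ V)
    {ν : ℝ} (hν : ∀ x ∈ V, ν * ‖x‖ ^ 2 ≤ inner ℝ (T x) x) : ν ≤ lam i := by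
  obtain ⟨x, hxV, hx0, hx⟩ := exists_ne_zero_mem_forall_inner_eq_zero hi fun k => φ k
  have hle := (hν x hxV).trans (h.inner_apply_le hT hc fun k hk => hx ⟨k, hk⟩)
  exact le_of_mul_le_mul_right hle (by positivity)

theorem inner_apply_le_of_eigenvectors {i : ℕ} {ψ : Fin i → E} (hψ : Orthonormal ℝ ψ)
    (hTψ : ∀ j : Fin i, T (ψ j) = lam j • ψ j) {x : E} (hx : ∀ j, inner ℝ (ψ j) x = 0) :
    inner ℝ (T x) x ≤ lam i * ‖x‖ ^ 2 := by
  classical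
  -- `m` is the first index of the block of indices on which `lam` takes the value `lam i`.
  let hex : ∃ k, lam k ≤ lam i := ⟨i, le_rfl⟩
  let m := Nat.find hex
  have hmi : m ≤ i := Nat.find_min' hex le_rfl
  have hspan := h.span_eq_of_lt hT
    (fun j hj => (Nat.find_spec hex).trans_lt (not_le.1 (Nat.find_min hex hj)))
    (hψ.comp _ (Fin.castLE_injective hmi)) fun j => hTψ (Fin.castLE hmi j)
  have hxm : x ∈ (Submodule.span ℝ (φ '' Set.Iio m))ᗮ := by
    rw [← hspan, mem_orthogonal_span_iff]
    rintro _ ⟨j, rfl⟩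
    exact hx _
  exact (h.inner_apply_le hT hc fun k hk => hxm _ (Submodule.subset_span ⟨k, hk, rfl⟩)).trans
    (mul_le_mul_of_nonneg_right (Nat.find_spec hex) (sq_nonneg _))

end IsEigensystem

end Eigensystems

section KyFan

variable {E : Type*} [NormedAddCommGroup E] [InnerProductSpace ℝ E]

theorem exists_orthonormalBasis_inner_apply_eq_ite {T : E →ₗ[ℝ] E} (hT : T.IsSymmetric)
    {H : Submodule ℝ E} [FiniteDimensional ℝ H] {M : ℕ} (hM : Module.finrank ℝ H = M) :
    ∃ (b : OrthonormalBasis (Fin M) ℝ H) (ν : Fin M → ℝ), Antitone ν ∧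
      ∀ i j, inner ℝ (T (b i)) (b j : E) = if i = j then ν i else 0 := by
  let S : H →ₗ[ℝ] H := H.orthogonalProjectionOnto.toLinearMap ∘ₗ T ∘ₗ H.subtype
  have hinner : ∀ x y : H, inner ℝ (S x) y = inner ℝ (T x) (y : E) := fun x y =>
    Submodule.inner_orthogonalProjectionOnto_eq_of_mem_right y (T x)
  have hS : S.IsSymmetric := fun x y => by
    rw [hinner, hT, real_inner_comm (S y) x, hinner, real_inner_comm]
  refine ⟨hS.eigenvectorBasis hM, hS.eigenvalues hM, hS.eigenvalues_antitone hM, fun i j => ?_⟩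
  rw [← hinner, hS.apply_eigenvectorBasis, RCLike.ofReal_real_eq_id, id_eq, real_inner_smul_left,
    orthonormal_iff_ite.1 (hS.eigenvectorBasis hM).orthonormal, mul_ite, mul_one, mul_zero]

theorem mul_norm_sq_le_inner_apply_of_mem_span {ι : Type*} [Finite ι] [DecidableEq ι]
    {T : E →ₗ[ℝ] E} {b : ι → E} (hb : Orthonormal ℝ b) {ν : ι → ℝ}
    (hTb : ∀ i j, inner ℝ (T (b i)) (b j) = if i = j then ν i else 0) {μ : ℝ}
    (hμ : ∀ i, μ ≤ ν i) {x : E} (hx : x ∈ Submodule.span ℝ (Set.range b)) :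
    μ * ‖x‖ ^ 2 ≤ inner ℝ (T x) x := by
  cases nonempty_fintype ι
  obtain ⟨c, rfl⟩ := (Submodule.mem_span_range_iff_exists_fun ℝ).1 hx
  have hnorm : ‖∑ i, c i • b i‖ ^ 2 = ∑ i, c i ^ 2 := by
    rw [← real_inner_self_eq_norm_sq, hb.inner_sum]
    simp [sq]
  have hform : inner ℝ (T (∑ i, c i • b i)) (∑ i, c i • b i) = ∑ i, ν i * c i ^ 2 := by
    simp only [map_sum, map_smul, sum_inner, inner_sum, real_inner_smul_left,
      real_inner_smul_right, hTb, mul_ite, mul_zero, Finset.sum_ite_eq', Finset.mem_univ, if_true]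
    exact Finset.sum_congr rfl fun i _ => by ring
  rw [hnorm, hform, Finset.mul_sum]
  exact Finset.sum_le_sum fun i _ => mul_le_mul_of_nonneg_right (hμ i) (sq_nonneg _)

namespace IsEigensystem

variable [CompleteSpace E] {T : E →L[ℝ] E} {lam : ℕ → ℝ} {φ : ℕ → E}
  (h : IsEigensystem T lam φ) (hT : T.IsPositive) (hc : IsCompactOperator T)
  {M : ℕ} {b : Fin M → E} {ν : Fin M → ℝ}
include h hT hc

theorem diagonal_le_eigenvalue (hb : Orthonormal ℝ b) (hν : Antitone ν)
    (hTb : ∀ i j, inner ℝ (T (b i)) (b j) = if i = j then ν i else 0) (i : Fin M) :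
    ν i ≤ lam i := by
  let u : Fin (i + 1) → Fin M := Fin.castLE i.2
  have hu : Function.Injective u := Fin.castLE_injective _
  have hbu : Orthonormal ℝ (b ∘ u) := hb.comp u hu
  refine h.le_eigenvalue_of_lt_finrank hT hc (V := Submodule.span ℝ (Set.range (b ∘ u)))
    (by simp [finrank_span_eq_card hbu.linearIndependent]) fun x hx => ?_
  exact mul_norm_sq_le_inner_apply_of_mem_span (T := T.toLinearMap) (ν := ν ∘ u) hbu
    (fun j k => by simpa [hu.eq_iff] using! hTb (u j) (u k))
    (fun j => hν (Fin.mk_le_mk.2 (Nat.lt_succ_iff.1 j.2))) hx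

theorem apply_eq_of_inner_apply_eq (hb : Orthonormal ℝ b)
    (hTb : ∀ i : Fin M, inner ℝ (T (b i)) (b i) = lam i) (i : Fin M) :
    T (b i) = lam i • b i := by
  obtain ⟨i, hi⟩ := i
  induction i using Nat.strong_induction_on with
  | _ i ih =>
    let ψ : Fin i → E := fun j => b (Fin.castLE hi.le j)
    have hTψ : ∀ j, T (ψ j) = lam j • ψ j := fun j => ih j j.2 _
    have hmem : b ⟨i, hi⟩ ∈ (Submodule.span ℝ (Set.range ψ))ᗮ :=
      mem_orthogonal_span_iff.2 <| Set.forall_mem_range.2 fun j =>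
        hb.2 fun hj => j.2.ne (congrArg Fin.val hj)
    refine apply_eq_smul_of_isMax (T := T.toLinearMap) hT.isSymmetric (fun z hz => ?_)
      (fun z hz => ?_) hmem (by simpa [hb.1] using! hTb ⟨i, hi⟩)
    · exact apply_mem_orthogonal_span_of_eigenvectors hT.isSymmetric
        (Set.forall_mem_range.2 fun j : Fin i => ⟨lam j, hTψ j⟩) hz
    · exact h.inner_apply_le_of_eigenvectors hT hc (hb.comp _ (Fin.castLE_injective hi.le)) hTψ
        fun j => hz _ (Submodule.subset_span ⟨j, rfl⟩)

theorem apply_eq_of_sum_eq (hb : Orthonormal ℝ b) (hν : Antitone ν)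
    (hTb : ∀ i j, inner ℝ (T (b i)) (b j) = if i = j then ν i else 0)
    (hsum : ∑ i, ν i = ∑ i : Fin M, lam i) (i : Fin M) : T (b i) = lam i • b i := by
  have heq := (Finset.sum_eq_sum_iff_of_le fun i _ =>
    h.diagonal_le_eigenvalue hT hc hb hν hTb i).1 hsum
  exact h.apply_eq_of_inner_apply_eq hT hc hb (fun i => by simp [hTb, heq i]) i

end IsEigensystem

end KyFan

section RandomElements

variable {Ω : Type*} [MeasurableSpace Ω] {P : Measure Ω}
  {E : Type*} [NormedAddCommGroup E] [InnerProductSpace ℝ E]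

theorem norm_sq_eq_integral_norm_sq (f : Lp E 2 P) : ‖f‖ ^ 2 = ∫ ω, ‖f ω‖ ^ 2 ∂P := by
  simp only [← real_inner_self_eq_norm_sq, L2.inner_def]

/-- The operator `a ↦ ⟪a, w ·⟫` from `E` to `L²(Ω)` attached to a random element `w ∈ L²(Ω; E)`,
taking a direction to the random coefficient of `w` along it. -/
noncomputable def coeffOp (w : Lp E 2 P) : E →L[ℝ] Lp ℝ 2 P :=
  (ContinuousLinearMap.compLpL₂ 2 P (innerSL ℝ)).flip w

theorem coeffOp_ae_eq (w : Lp E 2 P) (a : E) : coeffOp w a =ᵐ[P] fun ω => inner ℝ a (w ω) :=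
  ContinuousLinearMap.coeFn_compLp _ w

theorem inner_coeffOp (w : Lp E 2 P) (a b : E) :
    inner ℝ (coeffOp w a) (coeffOp w b) = ∫ ω, inner ℝ a (w ω) * inner ℝ b (w ω) ∂P := by
  rw [L2.inner_def]
  refine integral_congr_ae ?_
  filter_upwards [coeffOp_ae_eq w a, coeffOp_ae_eq w b] with ω ha hb
  rw [ha, hb, RCLike.inner_apply', conj_trivial]

theorem coeffOp_indicatorConstLp {s : Set Ω} (hs : MeasurableSet s) (hPs : P s ≠ ⊤) (c : E) :
    coeffOp (indicatorConstLp 2 hs hPs c) =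
      InnerProductSpace.rankOne ℝ (indicatorConstLp 2 hs hPs (1 : ℝ)) c := by
  ext1 a
  rw [InnerProductSpace.rankOne_apply]
  refine Lp.ext ?_
  filter_upwards [coeffOp_ae_eq (indicatorConstLp 2 hs hPs c) a,
    indicatorConstLp_coeFn (p := 2) (hs := hs) (hμs := hPs) (c := c),
    indicatorConstLp_coeFn (p := 2) (hs := hs) (hμs := hPs) (c := (1 : ℝ)),
    Lp.coeFn_smul (inner ℝ c a) (indicatorConstLp 2 hs hPs (1 : ℝ))] with ω h hc h1 hsmul
  rw [h, hc, hsmul, Pi.smul_apply, h1]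
  by_cases hω : ω ∈ s <;> simp [hω, real_inner_comm]

theorem coeffOp_add (w w' : Lp E 2 P) : coeffOp (w + w') = coeffOp w + coeffOp w' :=
  map_add _ w w'

theorem continuous_coeffOp : Continuous (coeffOp : Lp E 2 P → E →L[ℝ] Lp ℝ 2 P) :=
  ContinuousLinearMap.continuous _

theorem isCompactOperator_coeffOp (w : Lp E 2 P) : IsCompactOperator (coeffOp w) := by
  induction w using Lp.induction (p := 2) ENNReal.ofNat_ne_top with
  | @indicatorConst c s hs hPs =>
    rw [Lp.simpleFunc.coe_indicatorConst, coeffOp_indicatorConstLp]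
    exact (isCompactOperator_of_locallyCompactSpace_dom (innerSL ℝ c)).clm_comp
      (ContinuousLinearMap.toSpanSingleton ℝ _)
  | add hf hg _ h h' =>
    rw [coeffOp_add]
    exact h.add h'
  | isClosed =>
    have hclosed : IsClosed {T : E →L[ℝ] Lp ℝ 2 P | IsCompactOperator T} :=
      isClosed_setOfPred_isCompactOperator
    exact hclosed.preimage continuous_coeffOp

theorem norm_sub_starProjection_sq {ι : Type*} [Fintype ι] {H : Submodule ℝ E}
    [H.HasOrthogonalProjection] (b : OrthonormalBasis ι ℝ H) (x : E) :
    ‖x - H.starProjection x‖ ^ 2 = ‖x‖ ^ 2 - ∑ i, inner ℝ (b i : E) x ^ 2 := by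
  have hsum : ∑ i, inner ℝ (b i : E) x ^ 2 = ‖H.starProjection x‖ ^ 2 := by
    rw [Submodule.starProjection_apply, Submodule.norm_coe, ← b.sum_sq_inner_right]
    exact Finset.sum_congr rfl fun i _ => by
      rw [Submodule.inner_orthogonalProjectionOnto_eq_of_mem_left]
  rw [hsum, H.norm_sq_eq_add_norm_sq_starProjection x, Submodule.starProjection_orthogonal_val]
  ring

theorem norm_sub_starProjection_compLp_sq {ι : Type*} [Fintype ι] {H : Submodule ℝ E}
    [H.HasOrthogonalProjection] (b : OrthonormalBasis ι ℝ H) (w : Lp E 2 P) :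
    ‖w - H.starProjection.compLp w‖ ^ 2 = ‖w‖ ^ 2 - ∑ i, ‖coeffOp w (b i)‖ ^ 2 := by
  have hint : ∀ i, Integrable (fun ω => inner ℝ (b i : E) (w ω) ^ 2) P := fun i =>
    ((Lp.memLp w).const_inner (b i : E)).integrable_sq
  have hcoeff : ∀ i, ‖coeffOp w (b i)‖ ^ 2 = ∫ ω, inner ℝ (b i : E) (w ω) ^ 2 ∂P := fun i => by
    simp only [← real_inner_self_eq_norm_sq, inner_coeffOp, ← sq]
  simp only [hcoeff, norm_sq_eq_integral_norm_sq]
  rw [← integral_finsetSum _ fun i _ => hint i,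
    ← integral_sub ((Lp.memLp w).integrable_norm_pow two_ne_zero)
      (integrable_finsetSum _ fun i _ => hint i)]
  refine integral_congr_ae ?_
  filter_upwards [Lp.coeFn_sub w (H.starProjection.compLp w),
    H.starProjection.coeFn_compLp w] with ω hsub hproj
  rw [hsub, Pi.sub_apply, hproj, norm_sub_starProjection_sq b]

theorem ae_mem_of_coeffOp_eq_zero {K : Submodule ℝ E} [CompleteSpace E] [CompleteSpace K]
    {w : Lp E 2 P} (hw : ∀ a ∈ Kᗮ, coeffOp w a = 0) : ∀ᵐ ω ∂P, w ω ∈ K := by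
  have hf : Kᗮ.starProjection.compLp w =ᵐ[P] fun ω => Kᗮ.starProjection (w ω) :=
    Kᗮ.starProjection.coeFn_compLp' w
  obtain ⟨t, ht, hft⟩ := (Lp.aestronglyMeasurable (Kᗮ.starProjection.compLp w)).isSeparable_ae_range
  have hzero : Kᗮ.starProjection.compLp w =ᵐ[P] 0 := by
    refine ae_eq_zero_of_forall_dual_of_isSeparable ℝ ht (fun c => ?_) hft
    obtain ⟨a, rfl⟩ := (InnerProductSpace.toDual ℝ E).surjective c
    filter_upwards [coeffOp_ae_eq w (Kᗮ.starProjection a), hf, Lp.coeFn_zero ℝ 2 P] with ω ha hω h0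
    rw [hω, InnerProductSpace.toDual_apply_apply, ← Submodule.inner_starProjection_left_eq_right,
      ← ha, hw _ (Submodule.starProjection_apply_mem _ _), h0]
  filter_upwards [hzero, hf] with ω h0 hω
  rw [hω, Pi.zero_apply, Submodule.starProjection_orthogonal_val, sub_eq_zero] at h0
  exact Submodule.starProjection_eq_self_iff.1 h0.symm

section Expansion

variable {ι : Type*} {φ : ι → E}

theorem norm_sub_sum_rankOne_compLp_sq (hφ : Orthonormal ℝ φ) (w : Lp E 2 P) (s : Finset ι) :
    ‖w - ∑ k ∈ s, (InnerProductSpace.rankOne ℝ (φ k) (φ k)).compLp w‖ ^ 2 =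
      ‖w‖ ^ 2 - ∑ k ∈ s, ‖coeffOp w (φ k)‖ ^ 2 := by
  obtain ⟨b, hb⟩ := exists_orthonormalBasis_coe_eq (hφ.comp ((↑) : s → ι) Subtype.val_injective)
  have : FiniteDimensional ℝ (Submodule.span ℝ (Set.range (φ ∘ ((↑) : s → ι)))) :=
    FiniteDimensional.span_of_finite ℝ (Set.finite_range _)
  have hsum : ∑ k ∈ s, (InnerProductSpace.rankOne ℝ (φ k) (φ k)).compLp w =
      (Submodule.span ℝ (Set.range (φ ∘ ((↑) : s → ι)))).starProjection.compLp w := by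
    rw [b.starProjection_eq_sum_rankOne]
    simp only [hb, Function.comp_apply]
    rw [Finset.sum_coe_sort s fun k => InnerProductSpace.rankOne ℝ (φ k) (φ k)]
    exact (map_sum ((ContinuousLinearMap.compLpL₂ 2 P (.id ℝ (E →L[ℝ] E))).flip w) _ s).symm
  rw [hsum, norm_sub_starProjection_compLp_sq b]
  simp only [hb, Function.comp_apply]
  rw [Finset.sum_coe_sort s fun k => ‖coeffOp w (φ k)‖ ^ 2]

theorem hasSum_norm_coeffOp_sq [CompleteSpace E] [Countable ι] (hφ : Orthonormal ℝ φ) {w : Lp E 2 P}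
    (hw : ∀ᵐ ω ∂P, w ω ∈ (Submodule.span ℝ (Set.range φ)).topologicalClosure) :
    HasSum (fun k => ‖coeffOp w (φ k)‖ ^ 2) (‖w‖ ^ 2) := by
  have hcoeff : ∀ k, ‖coeffOp w (φ k)‖ ^ 2 = ∫ ω, inner ℝ (φ k) (w ω) ^ 2 ∂P := fun k => by
    simp only [← real_inner_self_eq_norm_sq, inner_coeffOp, ← sq]
  have hsummable : Summable fun k => ‖coeffOp w (φ k)‖ ^ 2 :=
    summable_of_sum_le (fun _ => sq_nonneg _) fun s => sub_nonneg.1 <|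
      norm_sub_sum_rankOne_compLp_sq hφ w s ▸ sq_nonneg _
  have hsum := hasSum_integral_of_summable_integral_norm
    (fun k => ((Lp.memLp w).const_inner (φ k)).integrable_sq)
    (by simpa only [Real.norm_of_nonneg (sq_nonneg _), ← hcoeff] using hsummable)
  have hnorm : ∫ ω, ∑' k, inner ℝ (φ k) (w ω) ^ 2 ∂P = ‖w‖ ^ 2 := by
    rw [norm_sq_eq_integral_norm_sq]
    exact integral_congr_ae <| hw.mono fun ω hω =>
      (hasSum_inner_sq_of_mem_topologicalClosure_span hφ hω).tsum_eq
  simpa only [hcoeff, hnorm] using hsum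

theorem hasSum_rankOne_compLp (hφ : Orthonormal ℝ φ) {w : Lp E 2 P}
    (hw : HasSum (fun k => ‖coeffOp w (φ k)‖ ^ 2) (‖w‖ ^ 2)) :
    HasSum (fun k => (InnerProductSpace.rankOne ℝ (φ k) (φ k)).compLp w) w := by
  have hlim : Tendsto (fun s : Finset ι => √(‖w‖ ^ 2 - ∑ k ∈ s, ‖coeffOp w (φ k)‖ ^ 2)) atTop
      (𝓝 √(‖w‖ ^ 2 - ‖w‖ ^ 2)) := (tendsto_const_nhds.sub hw).sqrt
  rw [HasSum, SummationFilter.unconditional_filter, tendsto_iff_norm_sub_tendsto_zero]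
  simpa only [← norm_sub_sum_rankOne_compLp_sq hφ, Real.sqrt_sq (norm_nonneg _), sub_self,
    Real.sqrt_zero, norm_sub_rev] using hlim

end Expansion

end RandomElements

section CovarianceOperators

variable {Ω : Type*} [MeasurableSpace Ω] {P : Measure Ω}
  {E : Type*} [NormedAddCommGroup E] [InnerProductSpace ℝ E] [CompleteSpace E]

/-- The operator `a ↦ ∫ ω, ⟪a, w ω⟫ • w ω ∂P` of second moments of a random element `w`. It is the
covariance operator of `w` when `w` has mean zero. -/
noncomputable def uncenteredCovOp (w : Lp E 2 P) : E →L[ℝ] E :=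
  (coeffOp w).adjoint.comp (coeffOp w)

theorem inner_uncenteredCovOp (w : Lp E 2 P) (a b : E) :
    inner ℝ (uncenteredCovOp w a) b = inner ℝ (coeffOp w a) (coeffOp w b) :=
  ContinuousLinearMap.adjoint_inner_left (coeffOp w) b (coeffOp w a)

theorem inner_uncenteredCovOp_eq_integral (w : Lp E 2 P) (a b : E) :
    inner ℝ (uncenteredCovOp w a) b = ∫ ω, inner ℝ a (w ω) * inner ℝ b (w ω) ∂P := by
  rw [inner_uncenteredCovOp, inner_coeffOp]

theorem inner_uncenteredCovOp_self (w : Lp E 2 P) (a : E) :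
    inner ℝ (uncenteredCovOp w a) a = ‖coeffOp w a‖ ^ 2 := by
  rw [inner_uncenteredCovOp, real_inner_self_eq_norm_sq]

theorem isPositive_uncenteredCovOp (w : Lp E 2 P) : (uncenteredCovOp w).IsPositive :=
  ContinuousLinearMap.isPositive_adjoint_comp_self _

theorem isCompactOperator_uncenteredCovOp (w : Lp E 2 P) :
    IsCompactOperator (uncenteredCovOp w) :=
  (isCompactOperator_coeffOp w).clm_comp (coeffOp w).adjoint

theorem norm_sub_starProjection_compLp_sq_eq_sub_sum {ι : Type*} [Fintype ι] {H : Submodule ℝ E}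
    [H.HasOrthogonalProjection] (b : OrthonormalBasis ι ℝ H) (w : Lp E 2 P) :
    ‖w - H.starProjection.compLp w‖ ^ 2 =
      ‖w‖ ^ 2 - ∑ i, inner ℝ (uncenteredCovOp w (b i)) (b i : E) := by
  simp only [norm_sub_starProjection_compLp_sq b, inner_uncenteredCovOp_self]

namespace IsEigensystem

variable {w : Lp E 2 P} {lam : ℕ → ℝ} {φ : ℕ → E}

theorem norm_coeffOp_sq (h : IsEigensystem (uncenteredCovOp w) lam φ) (k : ℕ) :
    ‖coeffOp w (φ k)‖ ^ 2 = lam k := by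
  rw [← inner_uncenteredCovOp_self, h.apply_eq, real_inner_smul_left, real_inner_self_eq_norm_sq,
    h.orthonormal.1, one_pow, mul_one]

variable (h : IsEigensystem (uncenteredCovOp w) lam φ)
include h

theorem ae_mem_topologicalClosure_span :
    ∀ᵐ ω ∂P, w ω ∈ (Submodule.span ℝ (Set.range φ)).topologicalClosure := by
  have : CompleteSpace (Submodule.span ℝ (Set.range φ)).topologicalClosure :=
    (Submodule.isClosed_topologicalClosure _).completeSpace_coe
  refine ae_mem_of_coeffOp_eq_zero fun a ha => ?_
  rw [Submodule.orthogonal_closure] at ha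
  have hCa : uncenteredCovOp w a = 0 :=
    h.apply_eq_zero (isPositive_uncenteredCovOp w) (isCompactOperator_uncenteredCovOp w) ha
  rw [← norm_eq_zero, ← sq_eq_zero_iff, ← inner_uncenteredCovOp_self, hCa, inner_zero_left]

theorem hasSum_eigenvalues : HasSum lam (‖w‖ ^ 2) := by
  simpa only [h.norm_coeffOp_sq] using
    hasSum_norm_coeffOp_sq h.orthonormal h.ae_mem_topologicalClosure_span

theorem hasSum_rankOne_compLp :
    HasSum (fun k => (InnerProductSpace.rankOne ℝ (φ k) (φ k)).compLp w) w :=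
  _root_.hasSum_rankOne_compLp h.orthonormal
    (hasSum_norm_coeffOp_sq h.orthonormal h.ae_mem_topologicalClosure_span)

theorem tsum_tail_eq (M : ℕ) : ∑' k, lam (M + k) = ‖w‖ ^ 2 - ∑ i : Fin M, lam i := by
  rw [← h.hasSum_eigenvalues.tsum_eq, ← h.hasSum_eigenvalues.summable.sum_add_tsum_nat_add M,
    Fin.sum_univ_eq_sum_range]
  simp only [add_comm M, add_sub_cancel_left]

theorem norm_sub_starProjection_span_range {M : ℕ} {ψ : Fin M → E}
    [(Submodule.span ℝ (Set.range ψ)).HasOrthogonalProjection] (hψ : Orthonormal ℝ ψ)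
    (hTψ : ∀ i : Fin M, uncenteredCovOp w (ψ i) = lam i • ψ i) :
    ‖w - (Submodule.span ℝ (Set.range ψ)).starProjection.compLp w‖ = √(∑' k, lam (M + k)) := by
  obtain ⟨b, hb⟩ := exists_orthonormalBasis_coe_eq hψ
  have hdiag : ∀ i, inner ℝ (uncenteredCovOp w (b i)) (b i : E) = lam i := fun i => by
    rw [hb, hTψ, real_inner_smul_left, real_inner_self_eq_norm_sq, hψ.1, one_pow, mul_one]
  rw [h.tsum_tail_eq, ← Real.sqrt_sq (norm_nonneg (w - _)),
    norm_sub_starProjection_compLp_sq_eq_sub_sum b]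
  simp only [hdiag]

variable {H : Submodule ℝ E} [FiniteDimensional ℝ H] {M : ℕ} (hM : Module.finrank ℝ H = M)
include hM

theorem sqrt_tsum_tail_le_norm_sub_starProjection :
    √(∑' k, lam (M + k)) ≤ ‖w - H.starProjection.compLp w‖ := by
  have hpos := isPositive_uncenteredCovOp w
  obtain ⟨b, ν, hν, hTb⟩ := exists_orthonormalBasis_inner_apply_eq_ite hpos.isSymmetric hM
  have hdiag : ∀ i, inner ℝ (uncenteredCovOp w (b i)) (b i : E) = ν i := fun i =>
    (hTb i i).trans (if_pos rfl)
  refine Real.sqrt_le_iff.2 ⟨norm_nonneg _, ?_⟩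
  rw [h.tsum_tail_eq, norm_sub_starProjection_compLp_sq_eq_sub_sum b]
  simp only [hdiag]
  gcongr with i
  exact h.diagonal_le_eigenvalue hpos (isCompactOperator_uncenteredCovOp w) (coe_orthonormal b)
    hν hTb i

theorem exists_orthonormal_of_norm_sub_starProjection_eq
    (heq : ‖w - H.starProjection.compLp w‖ = √(∑' k, lam (M + k))) :
    ∃ ψ : Fin M → E, Orthonormal ℝ ψ ∧ (∀ i : Fin M, uncenteredCovOp w (ψ i) = lam i • ψ i) ∧
      H = Submodule.span ℝ (Set.range ψ) := by
  have hpos := isPositive_uncenteredCovOp w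
  obtain ⟨b, ν, hν, hTb⟩ := exists_orthonormalBasis_inner_apply_eq_ite hpos.isSymmetric hM
  have hdiag : ∀ i, inner ℝ (uncenteredCovOp w (b i)) (b i : E) = ν i := fun i =>
    (hTb i i).trans (if_pos rfl)
  have hsq : ‖w - H.starProjection.compLp w‖ ^ 2 = ∑' k, lam (M + k) := by
    rw [heq, Real.sq_sqrt (tsum_nonneg fun k => h.nonneg (M + k))]
  rw [h.tsum_tail_eq, norm_sub_starProjection_compLp_sq_eq_sub_sum b, sub_right_inj] at hsq
  simp only [hdiag] at hsq
  exact ⟨fun i => b i, coe_orthonormal b, h.apply_eq_of_sum_eq hpos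
    (isCompactOperator_uncenteredCovOp w) (coe_orthonormal b) hν hTb hsq,
    (span_range_coe_eq b).symm⟩

end IsEigensystem

end CovarianceOperators

section JointVersions

variable {X : Type*} [MeasurableSpace X] {μ : Measure X} {Ω : Type*} [MeasurableSpace Ω]
  {P : Measure Ω} {F : Type*} [NormedAddCommGroup F] {p : ENNReal}

theorem ae_memLp_prodMk_left [SFinite μ] [SFinite P] {f : X × Ω → F} (hf : MemLp f p (μ.prod P))
    (hp0 : p ≠ 0) (hp : p ≠ ⊤) : ∀ᵐ x ∂μ, MemLp (fun ω => f (x, ω)) p P := by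
  have hint := (integrable_norm_rpow_iff hf.1 hp0 hp).2 hf
  filter_upwards [hf.1.prodMk_left, hint.prod_right_ae] with x hmeas hx
  exact (integrable_norm_rpow_iff hmeas hp0 hp).1 hx

variable [Fact (1 ≤ p)]

/-- `V` is a version `(x, ω) ↦ V x ω`, jointly measurable up to null sets, of the random element
`v` of `Lᵖ(μ; F)`. -/
structure IsJointVersion (v : Lp (Lp F p μ) p P) (V : X → Ω → F) : Prop where
  aestronglyMeasurable : AEStronglyMeasurable (Function.uncurry V) (μ.prod P)
  ae_eq : ∀ᵐ ω ∂P, (fun x => V x ω) =ᵐ[μ] v ω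

namespace IsJointVersion

variable {v v' : Lp (Lp F p μ) p P} {V V' : X → Ω → F}

theorem add (h : IsJointVersion v V) (h' : IsJointVersion v' V') :
    IsJointVersion (v + v') fun x ω => V x ω + V' x ω := by
  refine ⟨h.aestronglyMeasurable.add h'.aestronglyMeasurable, ?_⟩
  filter_upwards [h.ae_eq, h'.ae_eq, Lp.coeFn_add v v'] with ω hV hV' hadd
  rw [hadd]
  exact (hV.add hV').trans (Lp.coeFn_add (v ω) (v' ω)).symm

theorem sub (h : IsJointVersion v V) (h' : IsJointVersion v' V') :
    IsJointVersion (v - v') fun x ω => V x ω - V' x ω := by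
  refine ⟨h.aestronglyMeasurable.sub h'.aestronglyMeasurable, ?_⟩
  filter_upwards [h.ae_eq, h'.ae_eq, Lp.coeFn_sub v v'] with ω hV hV' hsub
  rw [hsub]
  exact (hV.sub hV').trans (Lp.coeFn_sub (v ω) (v' ω)).symm

theorem indicatorConst (c : Lp F p μ) {t : Set Ω} (ht : MeasurableSet t) (hPt : P t ≠ ⊤) :
    IsJointVersion (indicatorConstLp p ht hPt c) fun x => t.indicator fun _ => c x := by
  refine ⟨(Lp.aestronglyMeasurable c).comp_fst.indicator (measurable_snd ht), ?_⟩
  filter_upwards [indicatorConstLp_coeFn (p := p) (hs := ht) (hμs := hPt) (c := c)] with ω hω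
  rw [hω]
  by_cases hωt : ω ∈ t
  · simp only [Set.indicator_of_mem hωt, EventuallyEq.rfl]
  · simpa only [Set.indicator_of_notMem hωt] using! (Lp.coeFn_zero F p μ).symm

variable [SFinite μ] [SFinite P]

theorem eLpNorm_uncurry (h : IsJointVersion v V) (hp : p ≠ ⊤) :
    eLpNorm (Function.uncurry V) p (μ.prod P) = eLpNorm v p P := by
  have hp0 : p ≠ 0 := (zero_lt_one.trans_le Fact.out).ne'
  have hpos : 0 < p.toReal := ENNReal.toReal_pos hp0 hp
  simp only [eLpNorm_eq_lintegral_rpow_enorm_toReal hp0 hp]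
  rw [lintegral_prod_symm _ (h.aestronglyMeasurable.enorm.pow_const _)]
  congr 1
  refine lintegral_congr_ae ?_
  filter_upwards [h.ae_eq] with ω hω
  rw [Lp.enorm_def, ← eLpNorm_congr_ae hω, eLpNorm_eq_lintegral_rpow_enorm_toReal hp0 hp,
    ← ENNReal.rpow_mul, one_div_mul_cancel hpos.ne', ENNReal.rpow_one]
  rfl

theorem memLp (h : IsJointVersion v V) (hp : p ≠ ⊤) :
    MemLp (Function.uncurry V) p (μ.prod P) :=
  ⟨h.aestronglyMeasurable, h.eLpNorm_uncurry hp ▸ Lp.eLpNorm_lt_top v⟩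

theorem dist_toLp (h : IsJointVersion v V) (h' : IsJointVersion v' V') (hp : p ≠ ⊤) :
    dist ((h.memLp hp).toLp _) ((h'.memLp hp).toLp _) = dist v v' := by
  have hsub := (h.sub h').eLpNorm_uncurry hp
  rw [dist_eq_norm, dist_eq_norm, ← MemLp.toLp_sub, Lp.norm_toLp, Lp.norm_def, ← hsub]
  rfl

/-- A common almost everywhere convergent subsequence identifies the two limits slice by slice. -/
theorem of_tendsto {u : ℕ → Lp (Lp F p μ) p P} {W : ℕ → X → Ω → F}
    (hW : ∀ n, IsJointVersion (u n) (W n)) (hu : Tendsto u atTop (𝓝 v))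
    {Y : Lp F p (μ.prod P)} {Z : ℕ → Lp F p (μ.prod P)}
    (hZ : ∀ n, Z n =ᵐ[μ.prod P] Function.uncurry (W n)) (hY : Tendsto Z atTop (𝓝 Y)) :
    IsJointVersion v fun x ω => Y (x, ω) := by
  obtain ⟨ns, hns, hnsY⟩ := (tendstoInMeasure_of_tendsto_Lp hY).exists_seq_tendsto_ae
  obtain ⟨ms, hms, hmsv⟩ :=
    (tendstoInMeasure_of_tendsto_Lp (hu.comp hns.tendsto_atTop)).exists_seq_tendsto_ae
  have hslices : ∀ᵐ ω ∂P, ∀ᵐ x ∂μ, Tendsto (fun n => W (ns n) x ω) atTop (𝓝 (Y (x, ω))) := by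
    have hWY : ∀ᵐ z ∂μ.prod P,
        Tendsto (fun n => Function.uncurry (W (ns n)) z) atTop (𝓝 (Y z)) := by
      filter_upwards [hnsY, ae_all_iff.2 hZ] with z hz hZz
      simpa only [hZz] using hz
    exact Measure.ae_ae_of_ae_prod
      (Measure.measurePreserving_swap.quasiMeasurePreserving.ae hWY)
  refine ⟨Lp.aestronglyMeasurable Y, ?_⟩
  filter_upwards [hmsv, hslices, ae_all_iff.2 fun n => (hW n).ae_eq] with ω hv hWω hWu
  obtain ⟨ks, hks, hksv⟩ := (tendstoInMeasure_of_tendsto_Lp hv).exists_seq_tendsto_ae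
  filter_upwards [hksv, hWω, ae_all_iff.2 hWu] with x hx hWx hWux
  refine tendsto_nhds_unique (hWx.comp (hms.comp hks).tendsto_atTop) (hx.congr fun n => ?_)
  exact (hWux _).symm

end IsJointVersion

theorem exists_isJointVersion [SFinite μ] [SFinite P] [CompleteSpace F] (hp : p ≠ ⊤)
    (v : Lp (Lp F p μ) p P) : ∃ V, IsJointVersion v V := by
  induction v using Lp.induction (p := p) hp with
  | indicatorConst c hs hPs =>
    rw [Lp.simpleFunc.coe_indicatorConst]
    exact ⟨_, IsJointVersion.indicatorConst c hs hPs.ne⟩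
  | add hf hg _ hV hV' =>
    obtain ⟨V, hV⟩ := hV
    obtain ⟨V', hV'⟩ := hV'
    exact ⟨_, hV.add hV'⟩
  | isClosed =>
    refine IsSeqClosed.isClosed fun u v hu huv => ?_
    choose W hW using hu
    have hcauchy : CauchySeq fun n => ((hW n).memLp hp).toLp _ := by
      rw [Metric.cauchySeq_iff]
      simpa only [(hW _).dist_toLp (hW _) hp] using Metric.cauchySeq_iff.1 huv.cauchySeq
    obtain ⟨Y, hY⟩ := cauchySeq_tendsto_of_complete hcauchy
    exact ⟨_, .of_tendsto hW huv (fun n => ((hW n).memLp hp).coeFn_toLp) hY⟩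

end JointVersions

section SquareIntegrable

variable {Ω : Type*} [MeasurableSpace Ω] {P : Measure Ω}
  {F : Type*} [NormedAddCommGroup F]

theorem integrable_smul_of_memLp_two [NormedSpace ℝ F] {s : Ω → ℝ} (hs : MemLp s 2 P) {f : Ω → F}
    (hf : MemLp f 2 P) : Integrable (fun ω => s ω • f ω) P :=
  memLp_one_iff_integrable.1 (hf.smul (r := 1) hs)

theorem integrable_inner_of_memLp_two [InnerProductSpace ℝ F] {f g : Ω → F} (hf : MemLp f 2 P)
    (hg : MemLp g 2 P) : Integrable (fun ω => inner ℝ (f ω) (g ω)) P :=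
  (hf.norm.integrable_mul hg.norm).mono' (hf.1.inner hg.1) <|
    .of_forall fun ω => norm_inner_le_norm (f ω) (g ω)

theorem norm_integral_smul_sq_le [NormedSpace ℝ F] {s : Ω → ℝ} (hs : MemLp s 2 P) {f : Ω → F}
    (hf : MemLp f 2 P) :
    ‖∫ ω, s ω • f ω ∂P‖ ^ 2 ≤ (∫ ω, ‖s ω‖ ^ 2 ∂P) * ∫ ω, ‖f ω‖ ^ 2 ∂P := by
  have hCS := integral_mul_le_Lp_mul_Lq_of_nonneg Real.HolderConjugate.two_two
    (.of_forall fun ω => norm_nonneg (s ω)) (.of_forall fun ω => norm_nonneg (f ω))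
    (by simpa using hs.norm) (by simpa using hf.norm)
  simp only [Real.rpow_two, ← Real.sqrt_eq_rpow] at hCS
  rw [← Real.sqrt_le_sqrt_iff (by positivity), Real.sqrt_sq (norm_nonneg _),
    Real.sqrt_mul (by positivity)]
  calc ‖∫ ω, s ω • f ω ∂P‖ ≤ ∫ ω, ‖s ω • f ω‖ ∂P := norm_integral_le_integral_norm _
    _ ≤ _ := by simpa only [norm_smul] using hCS

theorem uncenteredCovOp_apply_eq_integral [InnerProductSpace ℝ F] [CompleteSpace F]
    (w : Lp F 2 P) (a : F) :
    uncenteredCovOp w a = ∫ ω, inner ℝ a (w ω) • w ω ∂P := by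
  have hint : Integrable (fun ω => inner ℝ a (w ω) • w ω) P :=
    integrable_smul_of_memLp_two ((Lp.memLp w).const_inner a) (Lp.memLp w)
  refine ext_inner_left ℝ fun b => ?_
  rw [← integral_inner hint, real_inner_comm, inner_uncenteredCovOp_eq_integral]
  simp only [real_inner_smul_right]

variable {X Y : Type*} [MeasurableSpace X] [MeasurableSpace Y] {μ : Measure X} {ν : Measure Y}

theorem memLp_prod_smul [NormedSpace ℝ F] {s : Ω → ℝ} (hs : MemLp s 2 P) {g : X → F}
    (hg : MemLp g 2 μ) : MemLp (fun z : X × Ω => s z.2 • g z.1) 2 (μ.prod P) := by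
  have hmeas : AEStronglyMeasurable (fun z : X × Ω => s z.2 • g z.1) (μ.prod P) :=
    hs.1.comp_snd.smul hg.1.comp_fst
  rw [memLp_two_iff_integrable_sq_norm hmeas]
  refine ((hg.integrable_norm_pow two_ne_zero).mul_prod
    (hs.integrable_norm_pow two_ne_zero)).congr (.of_forall fun z => ?_)
  simp only [norm_smul, mul_pow, mul_comm]

theorem integrable_inner_smul_prod [InnerProductSpace ℝ F] {G : Type*} [NormedAddCommGroup G]
    [NormedSpace ℝ G] {W : X → Ω → F} {f : X → F} (hf : MemLp f 2 μ)
    (hW : MemLp (Function.uncurry W) 2 (μ.prod P)) {g : Ω → G}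
    (hg : MemLp g 2 P) :
    Integrable (Function.uncurry fun y ω => inner ℝ (f y) (W y ω) • g ω) (μ.prod P) := by
  have hbound := (memLp_prod_smul hg.norm hf.norm).integrable_mul hW.norm
  refine hbound.mono' ((hf.1.comp_fst.inner hW.1).smul hg.1.comp_snd) (.of_forall fun z => ?_)
  calc ‖inner ℝ (f z.1) (W z.1 z.2) • g z.2‖
      ≤ (‖f z.1‖ * ‖W z.1 z.2‖) * ‖g z.2‖ := by
        rw [norm_smul]
        gcongr
        exact norm_inner_le_norm _ _
    _ = ‖g z.2‖ • ‖f z.1‖ * ‖Function.uncurry W z‖ := by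
        rw [smul_eq_mul, Function.uncurry_def]
        ring

variable [SFinite μ] [SFinite ν] [SFinite P]

theorem memLp_integral_smul_kernel [NormedSpace ℝ F] {f : X × Ω → ℝ} {g : Y × Ω → F}
    (hf : MemLp f 2 (μ.prod P)) (hg : MemLp g 2 (ν.prod P)) :
    MemLp (fun z : X × Y => ∫ ω, f (z.1, ω) • g (z.2, ω) ∂P) 2 (μ.prod ν) := by
  have hfst : Measure.QuasiMeasurePreserving (fun z : (X × Y) × Ω => (z.1.1, z.2))
      ((μ.prod ν).prod P) (μ.prod P) :=
    QuasiMeasurePreserving.prodMap Measure.quasiMeasurePreserving_fst (.id P)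
  have hsnd : Measure.QuasiMeasurePreserving (fun z : (X × Y) × Ω => (z.1.2, z.2))
      ((μ.prod ν).prod P) (ν.prod P) :=
    QuasiMeasurePreserving.prodMap Measure.quasiMeasurePreserving_snd (.id P)
  have hmeas : AEStronglyMeasurable (fun z : X × Y => ∫ ω, f (z.1, ω) • g (z.2, ω) ∂P)
      (μ.prod ν) :=
    ((hf.1.comp_quasiMeasurePreserving hfst).smul
      (hg.1.comp_quasiMeasurePreserving hsnd)).integral_prod_right'
  rw [memLp_two_iff_integrable_sq_norm hmeas]
  refine ((hf.integrable_norm_pow two_ne_zero).integral_prod_left.mul_prod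
    (hg.integrable_norm_pow two_ne_zero).integral_prod_left).mono' (hmeas.norm.pow 2) ?_
  filter_upwards [Measure.quasiMeasurePreserving_fst.ae
      (ae_memLp_prodMk_left hf two_ne_zero ENNReal.ofNat_ne_top),
    Measure.quasiMeasurePreserving_snd.ae
      (ae_memLp_prodMk_left hg two_ne_zero ENNReal.ofNat_ne_top)] with z hfz hgz
  rw [norm_pow, norm_norm]
  exact norm_integral_smul_sq_le hfz hgz

theorem memLp_integral_smul [NormedSpace ℝ F] {s : Ω → ℝ} (hs : MemLp s 2 P) {f : X × Ω → F}
    (hf : MemLp f 2 (μ.prod P)) : MemLp (fun x => ∫ ω, s ω • f (x, ω) ∂P) 2 μ := by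
  have hkernel := memLp_integral_smul_kernel (hs.comp_snd (Measure.dirac ())) hf
  simpa only [ae_dirac_eq, eventually_pure] using
    ae_memLp_prodMk_left hkernel two_ne_zero ENNReal.ofNat_ne_top

end SquareIntegrable

section Fubini

variable {X : Type*} [MeasurableSpace X] {μ : Measure X} [SFinite μ]
  {Ω : Type*} [MeasurableSpace Ω] {P : Measure Ω} [SFinite P]
  {F : Type*} [NormedAddCommGroup F] [InnerProductSpace ℝ F] [CompleteSpace F]
  {w : Lp (Lp F 2 μ) 2 P} {W : X → Ω → F}

/-- Both sides have the same inner product with every `g ∈ L²(μ; F)`, by Fubini's theorem. -/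
theorem IsJointVersion.integral_smul_ae_eq (h : IsJointVersion w W) {s : Ω → ℝ}
    (hs : MemLp s 2 P) :
    (∫ ω, s ω • w ω ∂P : Lp F 2 μ) =ᵐ[μ] fun x => ∫ ω, s ω • W x ω ∂P := by
  have hW := h.memLp ENNReal.ofNat_ne_top
  have hm : MemLp (fun x => ∫ ω, s ω • W x ω ∂P) 2 μ := memLp_integral_smul hs hW
  suffices heq : (∫ ω, s ω • w ω ∂P : Lp F 2 μ) = hm.toLp _ from heq ▸ hm.coeFn_toLp
  refine ext_inner_left ℝ fun g => ?_
  have hprod : Integrable (Function.uncurry fun x ω => inner ℝ (s ω • g x) (W x ω)) (μ.prod P) :=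
    integrable_inner_of_memLp_two (memLp_prod_smul hs (Lp.memLp g)) hW
  calc inner ℝ g (∫ ω, s ω • w ω ∂P)
      = ∫ ω, inner ℝ g (s ω • w ω) ∂P :=
        (integral_inner (integrable_smul_of_memLp_two hs (Lp.memLp w)) g).symm
    _ = ∫ ω, ∫ x, inner ℝ (s ω • g x) (W x ω) ∂μ ∂P := by
        refine integral_congr_ae ?_
        filter_upwards [h.ae_eq] with ω hω
        rw [real_inner_smul_right, L2.inner_def, ← integral_const_mul]
        refine integral_congr_ae ?_
        filter_upwards [hω] with x hx
        rw [← hx, real_inner_smul_left]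
    _ = ∫ x, ∫ ω, inner ℝ (s ω • g x) (W x ω) ∂P ∂μ := (integral_integral_swap hprod).symm
    _ = inner ℝ g (hm.toLp _) := by
        rw [L2.inner_def]
        refine integral_congr_ae ?_
        filter_upwards [hm.coeFn_toLp,
          ae_memLp_prodMk_left hW two_ne_zero ENNReal.ofNat_ne_top] with x hx hWx
        have hsW : Integrable (fun ω => s ω • W x ω) P := integrable_smul_of_memLp_two hs hWx
        simp only [hx, ← integral_inner hsW, real_inner_smul_left, real_inner_smul_right]

theorem IsJointVersion.uncenteredCovOp_ae_eq (h : IsJointVersion w W) (u : Lp F 2 μ) :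
    uncenteredCovOp w u =ᵐ[μ] fun x => ∫ y, ∫ ω, inner ℝ (u y) (W y ω) • W x ω ∂P ∂μ := by
  have hW := h.memLp ENNReal.ofNat_ne_top
  rw [uncenteredCovOp_apply_eq_integral]
  filter_upwards [h.integral_smul_ae_eq ((Lp.memLp w).const_inner u),
    ae_memLp_prodMk_left hW two_ne_zero ENNReal.ofNat_ne_top] with x hx hWx
  have hWx' : MemLp (W x) 2 P := hWx
  rw [hx, integral_integral_swap (integrable_inner_smul_prod (Lp.memLp u) hW hWx')]
  refine integral_congr_ae ?_
  filter_upwards [h.ae_eq] with ω hω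
  rw [integral_smul_const, L2.inner_def]
  congr 1
  exact integral_congr_ae (hω.mono fun y hy => congrArg (inner ℝ (u y)) hy.symm)

end Fubini

section TensorProducts

variable {Ω : Type*} [MeasurableSpace Ω] {P : Measure Ω}

theorem compLp_mem_topologicalClosure_span {E F : Type*} [NormedAddCommGroup E] [NormedSpace ℝ E]
    [NormedAddCommGroup F] [NormedSpace ℝ F] {p : ENNReal} [Fact (1 ≤ p)] (hp : p ≠ ⊤)
    (T : E →L[ℝ] F) {H : Submodule ℝ F} (hT : ∀ a, T a ∈ H) (w : Lp E p P) :
    T.compLp w ∈ (Submodule.span ℝ {f | ∃ φ ∈ H, ∃ s : Lp ℝ p P,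
      f = (ContinuousLinearMap.toSpanSingleton ℝ φ).compLp s}).topologicalClosure := by
  induction w using Lp.induction (p := p) hp with
  | @indicatorConst c s hs hPs =>
    refine Submodule.le_topologicalClosure _ (Submodule.subset_span ?_)
    refine ⟨T c, hT c, indicatorConstLp p hs hPs.ne 1, Lp.ext ?_⟩
    rw [Lp.simpleFunc.coe_indicatorConst]
    filter_upwards [T.coeFn_compLp (indicatorConstLp p hs hPs.ne c),
      (ContinuousLinearMap.toSpanSingleton ℝ (T c)).coeFn_compLp
        (indicatorConstLp p hs hPs.ne (1 : ℝ)),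
      indicatorConstLp_coeFn (p := p) (hs := hs) (hμs := hPs.ne) (c := c),
      indicatorConstLp_coeFn (p := p) (hs := hs) (hμs := hPs.ne) (c := (1 : ℝ))] with ω h₁ h₂ h₃ h₄
    rw [h₁, h₂, h₃, h₄]
    by_cases hω : ω ∈ s <;> simp [hω]
  | add hf hg _ h h' =>
    rw [← T.compLpₗ_apply, map_add]
    exact add_mem h h'
  | isClosed =>
    exact (Submodule.isClosed_topologicalClosure _).preimage (T.compLpL p P).continuous

variable {E : Type*} [NormedAddCommGroup E] [InnerProductSpace ℝ E]

theorem inner_toSpanSingleton_compLp_sub_starProjection_compLp {H : Submodule ℝ E}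
    [H.HasOrthogonalProjection] {φ : E} (hφ : φ ∈ H) (s : Lp ℝ 2 P) (w : Lp E 2 P) :
    inner ℝ ((ContinuousLinearMap.toSpanSingleton ℝ φ).compLp s)
      (w - H.starProjection.compLp w) = 0 := by
  rw [L2.inner_def]
  refine integral_eq_zero_of_ae ?_
  filter_upwards [(ContinuousLinearMap.toSpanSingleton ℝ φ).coeFn_compLp s,
    Lp.coeFn_sub w (H.starProjection.compLp w),
    H.starProjection.coeFn_compLp w] with ω hs hsub hproj
  rw [hs, hsub, Pi.sub_apply, hproj, ContinuousLinearMap.toSpanSingleton_apply,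
    real_inner_smul_left, H.inner_right_of_mem_orthogonal hφ
      (H.sub_starProjection_mem_orthogonal _), mul_zero, Pi.zero_apply]

end TensorProducts

section InfiniteDimensional

theorem not_finiteDimensional_Lp_of_pairwise_disjoint {X : Type*} [MeasurableSpace X]
    {μ : Measure X} {F : Type*} [NormedAddCommGroup F] [InnerProductSpace ℝ F] [Nontrivial F]
    {A : ℕ → Set X} (hA : ∀ n, MeasurableSet (A n)) (hdisj : Pairwise (Function.onFun Disjoint A))
    (hpos : ∀ n, μ (A n) ≠ 0) (hfin : ∀ n, μ (A n) ≠ ⊤) : ¬ FiniteDimensional ℝ (Lp F 2 μ) := by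
  intro hfinite
  obtain ⟨c, hc⟩ := exists_ne (0 : F)
  refine Module.Finite.not_linearIndependent_of_infinite (R := ℝ)
    (fun n => indicatorConstLp 2 (hA n) (hfin n) c)
    (linearIndependent_of_ne_zero_of_inner_eq_zero (𝕜 := ℝ) (fun n hn => ?_) fun m n hmn => ?_)
  · have hnorm := congrArg norm hn
    rw [norm_indicatorConstLp two_ne_zero ENNReal.ofNat_ne_top, norm_zero, mul_eq_zero,
      norm_eq_zero, Real.rpow_eq_zero measureReal_nonneg (by norm_num),
      measureReal_eq_zero_iff (hfin n)] at hnorm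
    exact hnorm.elim hc (hpos n)
  · refine (L2.inner_indicatorConstLp_eq_setIntegral_inner ℝ _ _ _ _).trans
      (integral_eq_zero_of_ae ((ae_restrict_iff' (hA m)).2 ?_))
    filter_upwards [indicatorConstLp_coeFn (p := 2) (hs := hA n) (hμs := hfin n) (c := c)]
      with x hx hxm
    rw [hx, Set.indicator_of_notMem (Set.disjoint_left.1 (hdisj hmn) hxm), inner_zero_right,
      Pi.zero_apply]

variable {X : Type*} [TopologicalSpace X] [T2Space X] [∀ x : X, NeBot (𝓝[≠] x)] {U : Set X}

theorem exists_seq_isOpen_pairwise_disjoint_subset (hU : IsOpen U) (hUne : U.Nonempty) :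
    ∃ A : ℕ → Set X, (∀ n, IsOpen (A n)) ∧ (∀ n, (A n).Nonempty) ∧ (∀ n, A n ⊆ U) ∧
      Pairwise (Function.onFun Disjoint A) := by
  obtain ⟨x, hx⟩ := hUne
  have : Infinite U := (infinite_of_mem_nhds x (hU.mem_nhds hx)).to_subtype
  obtain ⟨B, hBinf, hBopen, hBdisj⟩ := exists_seq_infinite_isOpen_pairwise_disjoint U
  exact ⟨fun n => Subtype.val '' B n, fun n => hU.isOpenMap_subtype_val _ (hBopen n),
    fun n => (hBinf n).nonempty.image _, fun n => Subtype.coe_image_subset U (B n),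
    fun m n hmn => (Set.disjoint_image_iff Subtype.val_injective).2 (hBdisj hmn)⟩

theorem not_finiteDimensional_Lp_restrict [MeasurableSpace X] [OpensMeasurableSpace X]
    {μ : Measure X} [IsLocallyFiniteMeasure μ] [μ.IsOpenPosMeasure] {F : Type*}
    [NormedAddCommGroup F] [InnerProductSpace ℝ F] [Nontrivial F] (hU : IsOpen U)
    (hUne : U.Nonempty) : ¬ FiniteDimensional ℝ (Lp F 2 (μ.restrict U)) := by
  obtain ⟨x, hx⟩ := hUne
  obtain ⟨B, hxB, hBopen, hBfin⟩ := μ.exists_isOpen_measure_lt_top x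
  obtain ⟨A, hAopen, hAne, hAsub, hAdisj⟩ :=
    exists_seq_isOpen_pairwise_disjoint_subset (hU.inter hBopen) ⟨x, hx, hxB⟩
  have hrestrict : ∀ n, μ.restrict U (A n) = μ (A n) := fun n =>
    Measure.restrict_eq_self μ ((hAsub n).trans Set.inter_subset_left)
  refine not_finiteDimensional_Lp_of_pairwise_disjoint (fun n => (hAopen n).measurableSet) hAdisj
    (fun n => ?_) fun n => ?_
  · rw [hrestrict]
    exact (hAopen n).measure_ne_zero μ (hAne n)
  · rw [hrestrict]
    exact measure_ne_top_of_subset ((hAsub n).trans Set.inter_subset_right) hBfin.ne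

end InfiniteDimensional

section Centering

variable {Ω : Type*} [MeasurableSpace Ω] {P : Measure Ω} {p : ENNReal}
  {E : Type*} [NormedAddCommGroup E]

/-- The random element `v - E[v]`. -/
noncomputable def centered [NormedSpace ℝ E] [IsFiniteMeasure P] (v : Lp E p P) : Lp E p P :=
  v - Lp.const p P (∫ ω, v ω ∂P)

theorem centered_ae_eq [NormedSpace ℝ E] [IsFiniteMeasure P] (v : Lp E p P) :
    centered v =ᵐ[P] fun ω => v ω - ∫ ω', v ω' ∂P := by
  filter_upwards [Lp.coeFn_sub v (Lp.const p P (∫ ω, v ω ∂P)),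
    Lp.coeFn_const (p := p) (μ := P) (∫ ω, v ω ∂P)] with ω hsub hconst
  rw [centered, hsub, Pi.sub_apply, hconst, Function.const_apply]

variable [IsProbabilityMeasure P]

theorem integral_centered [NormedSpace ℝ E] [CompleteSpace E] (hp : 1 ≤ p) (v : Lp E p P) :
    ∫ ω, centered v ω ∂P = 0 := by
  rw [integral_congr_ae (centered_ae_eq v),
    integral_sub ((Lp.memLp v).integrable hp) (integrable_const _), integral_const, probReal_univ,
    one_smul, sub_self]

theorem integral_inner_centered [InnerProductSpace ℝ E] [CompleteSpace E] (hp : 1 ≤ p)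
    (v : Lp E p P) (a : E) : ∫ ω, inner ℝ a (centered v ω) ∂P = 0 := by
  rw [integral_inner ((Lp.memLp (centered v)).integrable hp), integral_centered hp,
    inner_zero_right]

end Centering

section TensorSubspaces

variable {d q : ℕ} {Ω : Type*} [MeasurableSpace Ω] {P : Measure Ω}
  {U : Set (EuclideanSpace ℝ (Fin d))}

theorem starProjection_tensorSubspace (H : Submodule ℝ (L2Field U q)) [H.HasOrthogonalProjection]
    (w : RandomField P U q) :
    (tensorSubspace P H).starProjection w = H.starProjection.compLp w := by
  refine Submodule.eq_starProjection_of_mem_orthogonal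
    (compLp_mem_topologicalClosure_span ENNReal.ofNat_ne_top _ H.starProjection_apply_mem w) ?_
  rw [tensorSubspace, Submodule.orthogonal_closure, Submodule.mem_orthogonal]
  intro u hu
  induction hu using Submodule.span_induction with
  | mem u hu =>
    obtain ⟨φ, hφ, s, rfl⟩ := hu
    exact inner_toSpanSingleton_compLp_sub_starProjection_compLp hφ s w
  | zero => exact inner_zero_left _
  | add a b _ _ ha hb => rw [inner_add_left, ha, hb, add_zero]
  | smul c a _ ha => rw [real_inner_smul_left, ha, mul_zero]

theorem projError_eq (w : RandomField P U q) (H : Submodule ℝ (L2Field U q))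
    [H.HasOrthogonalProjection] : projError w H = ‖w - H.starProjection.compLp w‖ := by
  rw [projError, starProjection_tensorSubspace]

end TensorSubspaces

section PointwiseVersions

variable {d q : ℕ} {Ω : Type*} [MeasurableSpace Ω] {P : Measure Ω}
  {U : Set (EuclideanSpace ℝ (Fin d))} {v : RandomField P U q}
  {V : EuclideanSpace ℝ (Fin d) → Ω → EuclideanSpace ℝ (Fin q)}

theorem IsPointwiseVersion.isJointVersion (h : IsPointwiseVersion v V) : IsJointVersion v V :=
  ⟨h.aestronglyMeasurable, h.ae_eq⟩

theorem exists_isPointwiseVersion [SFinite P] (v : RandomField P U q) :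
    ∃ V, IsPointwiseVersion v V :=
  let ⟨V, hV⟩ := exists_isJointVersion ENNReal.ofNat_ne_top v
  ⟨V, hV.aestronglyMeasurable, hV.ae_eq⟩

variable [IsFiniteMeasure P]

theorem covMatrix_apply_eq_integral {x y : EuclideanSpace ℝ (Fin d)} (hx : MemLp (V x) 2 P)
    (hy : MemLp (V y) 2 P) (i j : Fin q) :
    covMatrix P V x y i j =
      ∫ ω, (V x ω - ∫ ω', V x ω' ∂P) i * (V y ω - ∫ ω', V y ω' ∂P) j ∂P := by
  simp only [covMatrix, Matrix.of_apply, covariance, PiLp.sub_apply,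
    eval_integral_piLp (hx.integrable one_le_two).eval_piLp,
    eval_integral_piLp (hy.integrable one_le_two).eval_piLp]

theorem toLp_mulVec_covMatrix {x y : EuclideanSpace ℝ (Fin d)} (hx : MemLp (V x) 2 P)
    (hy : MemLp (V y) 2 P) (u : EuclideanSpace ℝ (Fin q)) :
    WithLp.toLp 2 (Matrix.mulVec (covMatrix P V x y) u) =
      ∫ ω, inner ℝ u (V y ω - ∫ ω', V y ω' ∂P) • (V x ω - ∫ ω', V x ω' ∂P) ∂P := by
  have hWx : MemLp (fun ω => V x ω - ∫ ω', V x ω' ∂P) 2 P := hx.sub (memLp_const _)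
  have hWy : MemLp (fun ω => V y ω - ∫ ω', V y ω' ∂P) 2 P := hy.sub (memLp_const _)
  have hint := integrable_smul_of_memLp_two (hWy.const_inner u) hWx
  ext i
  have hterm : ∀ j ∈ Finset.univ, Integrable (fun ω =>
      (V x ω - ∫ ω', V x ω' ∂P) i * (V y ω - ∫ ω', V y ω' ∂P) j * u j) P := fun j _ =>
    ((hWx.eval_piLp i).integrable_mul (hWy.eval_piLp j)).mul_const _
  rw [eval_integral_piLp hint.eval_piLp]
  simp only [Matrix.mulVec, dotProduct, covMatrix_apply_eq_integral hx hy, ← integral_mul_const]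
  rw [← integral_finsetSum _ hterm]
  congr! 2 with ω
  rw [PiLp.smul_apply, smul_eq_mul, PiLp.inner_apply, Finset.sum_mul]
  refine Finset.sum_congr rfl fun j _ => ?_
  rw [RCLike.inner_apply, conj_trivial]
  ring

namespace IsPointwiseVersion

theorem meanField_ae_eq (h : IsPointwiseVersion v V) :
    meanField v =ᵐ[volume.restrict U] fun x => ∫ ω, V x ω ∂P := by
  simpa only [one_smul, meanField] using h.isJointVersion.integral_smul_ae_eq (memLp_const (1 : ℝ))

theorem ae_memLp (h : IsPointwiseVersion v V) :
    ∀ᵐ x ∂(volume.restrict U), MemLp (V x) 2 P :=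
  ae_memLp_prodMk_left (h.isJointVersion.memLp ENNReal.ofNat_ne_top) two_ne_zero
    ENNReal.ofNat_ne_top

theorem isJointVersion_centered (h : IsPointwiseVersion v V) :
    IsJointVersion (centered v) fun x ω => V x ω - ∫ ω', V x ω' ∂P := by
  have hmeas : AEStronglyMeasurable (fun x => ∫ ω, V x ω ∂P) (volume.restrict U) :=
    (Lp.aestronglyMeasurable (meanField v)).congr h.meanField_ae_eq
  refine h.isJointVersion.sub ⟨hmeas.comp_fst, ?_⟩
  filter_upwards [Lp.coeFn_const (p := 2) (μ := P) (∫ ω, v ω ∂P)] with ω hω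
  rw [hω]
  exact h.meanField_ae_eq.symm

theorem memLp_covMatrix (h : IsPointwiseVersion v V) (i j : Fin q) :
    MemLp (fun z : EuclideanSpace ℝ (Fin d) × EuclideanSpace ℝ (Fin d) =>
      covMatrix P V z.1 z.2 i j) 2 ((volume.restrict U).prod (volume.restrict U)) := by
  have hcoord : ∀ k, MemLp (fun z : EuclideanSpace ℝ (Fin d) × Ω =>
      (V z.1 z.2 - ∫ ω, V z.1 ω ∂P) k) 2 ((volume.restrict U).prod P) :=
    (h.isJointVersion_centered.memLp ENNReal.ofNat_ne_top).eval_piLp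
  refine (memLp_integral_smul_kernel (hcoord i) (hcoord j)).ae_eq ?_
  filter_upwards [Measure.quasiMeasurePreserving_fst.ae h.ae_memLp,
    Measure.quasiMeasurePreserving_snd.ae h.ae_memLp] with z hx hy
  exact (covMatrix_apply_eq_integral hx hy i j).symm

theorem covOp_ae_eq (h : IsPointwiseVersion v V) (u : L2Field U q) :
    covOp P U V u =ᵐ[volume.restrict U] uncenteredCovOp (centered v) u := by
  filter_upwards [h.ae_memLp, h.isJointVersion_centered.uncenteredCovOp_ae_eq u] with x hx hCx
  rw [hCx]
  exact integral_congr_ae (h.ae_memLp.mono fun y hy => toLp_mulVec_covMatrix hx hy (u y))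

theorem memLp_covOp (h : IsPointwiseVersion v V) (u : L2Field U q) :
    MemLp (covOp P U V u) 2 (volume.restrict U) :=
  (Lp.memLp (uncenteredCovOp (centered v) u)).ae_eq (h.covOp_ae_eq u).symm

theorem covEigen_iff (h : IsPointwiseVersion v V) (μ : ℝ) (u : L2Field U q) :
    CovEigen P V μ u ↔ uncenteredCovOp (centered v) u = μ • u := by
  rw [CovEigen, (h.covOp_ae_eq u).congr_left, Lp.ext_iff, (Lp.coeFn_smul μ u).congr_right]
  rfl

theorem isCovEigensystem_iff (h : IsPointwiseVersion v V) (lam : ℕ → ℝ) (φ : ℕ → L2Field U q) :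
    IsCovEigensystem P V lam φ ↔ IsEigensystem (uncenteredCovOp (centered v)) lam φ :=
  ⟨fun s => ⟨s.nonneg, s.antitone, s.orthonormal, fun k => (h.covEigen_iff _ _).1 (s.eigen k),
      fun μ u hμ hu => s.exhaustive μ u hμ ((h.covEigen_iff _ _).2 hu)⟩,
    fun s => ⟨s.nonneg, s.antitone, s.orthonormal, fun k => (h.covEigen_iff _ _).2 (s.apply_eq k),
      fun μ u hμ hu => s.exhaustive μ u hμ ((h.covEigen_iff _ _).1 hu)⟩⟩

end IsPointwiseVersion

end PointwiseVersions

section OptimalSubspaces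

variable {d q : ℕ} {Ω : Type*} [MeasurableSpace Ω] {P : Measure Ω}
  {U : Set (EuclideanSpace ℝ (Fin d))} {w : RandomField P U q}
  {lam : ℕ → ℝ} {φ : ℕ → L2Field U q}

theorem finrank_span_image_Iio {E : Type*} [AddCommGroup E] [Module ℝ E] {u : ℕ → E}
    (hu : LinearIndependent ℝ u) (n : ℕ) :
    Module.finrank ℝ (Submodule.span ℝ (u '' Set.Iio n)) = n := by
  rw [image_Iio_eq_range]
  exact (finrank_span_eq_card (hu.comp _ Fin.val_injective)).trans (Fintype.card_fin n)

namespace IsEigensystem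

variable (h : IsEigensystem (uncenteredCovOp w) lam φ)
include h

theorem projError_span_range {M : ℕ} {ψ : Fin M → L2Field U q} (hψ : Orthonormal ℝ ψ)
    (hTψ : ∀ i : Fin M, uncenteredCovOp w (ψ i) = lam i • ψ i) :
    projError w (Submodule.span ℝ (Set.range ψ)) = √(∑' k, lam (M + k)) := by
  have : FiniteDimensional ℝ (Submodule.span ℝ (Set.range ψ)) :=
    FiniteDimensional.span_of_finite ℝ (Set.finite_range ψ)
  rw [projError_eq, h.norm_sub_starProjection_span_range hψ hTψ]

theorem projError_span_image_Iio (M : ℕ) :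
    projError w (Submodule.span ℝ (φ '' Set.Iio M)) = √(∑' k, lam (M + k)) := by
  rw [image_Iio_eq_range]
  exact h.projError_span_range (h.orthonormal.comp _ Fin.val_injective) fun i => h.apply_eq i

theorem isLeast_projError (M : ℕ) :
    IsLeast {e : ℝ | ∃ H : Submodule ℝ (L2Field U q), FiniteDimensional ℝ H ∧
      Module.finrank ℝ H = M ∧ e = projError w H} √(∑' k, lam (M + k)) := by
  refine ⟨⟨Submodule.span ℝ (φ '' Set.Iio M),
    FiniteDimensional.span_of_finite ℝ ((Set.finite_Iio M).image φ),
    finrank_span_image_Iio h.orthonormal.linearIndependent M,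
    (h.projError_span_image_Iio M).symm⟩, ?_⟩
  rintro _ ⟨H, hH, hM, rfl⟩
  rw [projError_eq]
  exact h.sqrt_tsum_tail_le_norm_sub_starProjection hM

variable {H : Submodule ℝ (L2Field U q)} [FiniteDimensional ℝ H] {M : ℕ}
  (hM : Module.finrank ℝ H = M)
include hM

theorem projError_eq_iff :
    projError w H = √(∑' k, lam (M + k)) ↔
      ∃ ψ : Fin M → L2Field U q, Orthonormal ℝ ψ ∧
        (∀ i : Fin M, uncenteredCovOp w (ψ i) = lam i • ψ i) ∧
        H = Submodule.span ℝ (Set.range ψ) := by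
  constructor
  · rw [projError_eq]
    exact h.exists_orthonormal_of_norm_sub_starProjection_eq hM
  · rintro ⟨ψ, hψ, hTψ, rfl⟩
    exact h.projError_span_range hψ hTψ

theorem eq_span_of_projError_eq (hgap : ∀ i < M, lam M < lam i)
    (heq : projError w H = √(∑' k, lam (M + k))) : H = Submodule.span ℝ (φ '' Set.Iio M) := by
  obtain ⟨ψ, hψ, hTψ, rfl⟩ := (h.projError_eq_iff hM).1 heq
  exact h.span_eq_of_lt (isPositive_uncenteredCovOp w) hgap hψ hTψ

end IsEigensystem

end OptimalSubspaces

section KarhunenLoeve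

variable {d q : ℕ} {Ω : Type*} [MeasurableSpace Ω] {P : Measure Ω}
  {U : Set (EuclideanSpace ℝ (Fin d))} {lam : ℕ → ℝ} {φ : ℕ → L2Field U q}

theorem tendsto_eLpNorm_sub_sum_of_hasSum {E : Type*} [NormedAddCommGroup E] {p : ENNReal}
    [Fact (1 ≤ p)] {ι : Type*} [Countable ι] {f : ι → Lp E p P} {w : Lp E p P} (hf : HasSum f w)
    {g : ι → Ω → E} (hg : ∀ k, f k =ᵐ[P] g k) :
    Tendsto (fun s : Finset ι => eLpNorm (fun ω => w ω - ∑ k ∈ s, g k ω) p P) atTop (𝓝 0) := by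
  rw [HasSum, SummationFilter.unconditional_filter, Lp.tendsto_Lp_iff_tendsto_eLpNorm'] at hf
  refine hf.congr fun s => ?_
  rw [eLpNorm_sub_comm]
  refine eLpNorm_congr_ae ?_
  filter_upwards [Lp.coeFn_finsetSum s f, ae_all_iff.2 hg] with ω hsum hω
  simp only [Pi.sub_apply, hsum, Finset.sum_apply, hω]

theorem klCoeff_ae_eq [IsFiniteMeasure P] (v : RandomField P U q) (μ : ℝ) (u : L2Field U q) :
    klCoeff v μ u =ᵐ[P] fun ω => (√μ)⁻¹ * inner ℝ u (centered v ω) := by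
  filter_upwards [centered_ae_eq v] with ω hω
  rw [klCoeff, hω, real_inner_comm, L2.inner_def]
  congr 1
  refine integral_congr_ae ?_
  filter_upwards [Lp.coeFn_sub (v ω) (meanField v)] with x hx
  exact congrArg (inner ℝ · (u x)) hx.symm

theorem memLp_klCoeff [IsFiniteMeasure P] (v : RandomField P U q) (μ : ℝ) (u : L2Field U q) :
    MemLp (klCoeff v μ u) 2 P :=
  (((Lp.memLp (centered v)).const_inner u).const_mul _).ae_eq (klCoeff_ae_eq v μ u).symm

theorem integral_klCoeff [IsProbabilityMeasure P] (v : RandomField P U q) (μ : ℝ)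
    (u : L2Field U q) : ∫ ω, klCoeff v μ u ω ∂P = 0 := by
  rw [integral_congr_ae (klCoeff_ae_eq v μ u), integral_const_mul,
    integral_inner_centered one_le_two, mul_zero]

namespace IsEigensystem

variable [IsFiniteMeasure P] {v : RandomField P U q}
  (h : IsEigensystem (uncenteredCovOp (centered v)) lam φ)
include h

theorem integral_klCoeff_mul_klCoeff {k l : ℕ} (hk : 0 < lam k) :
    ∫ ω, klCoeff v (lam k) (φ k) ω * klCoeff v (lam l) (φ l) ω ∂P = if k = l then 1 else 0 := by
  have hscale : (fun ω => klCoeff v (lam k) (φ k) ω * klCoeff v (lam l) (φ l) ω) =ᵐ[P]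
      fun ω => ((√(lam k))⁻¹ * (√(lam l))⁻¹) *
        (inner ℝ (φ k) (centered v ω) * inner ℝ (φ l) (centered v ω)) := by
    filter_upwards [klCoeff_ae_eq v (lam k) (φ k), klCoeff_ae_eq v (lam l) (φ l)] with ω hωk hωl
    rw [hωk, hωl, mul_mul_mul_comm]
  rw [integral_congr_ae hscale, integral_const_mul, ← inner_uncenteredCovOp_eq_integral,
    h.apply_eq, real_inner_smul_left, orthonormal_iff_ite.1 h.orthonormal]
  split_ifs with hkl
  · rw [← hkl, mul_one, ← mul_inv, Real.mul_self_sqrt hk.le, inv_mul_cancel₀ hk.ne']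
  · rw [mul_zero, mul_zero]

theorem inner_centered_ae_eq (k : ℕ) :
    (fun ω => inner ℝ (φ k) (centered v ω)) =ᵐ[P]
      fun ω => √(lam k) * klCoeff v (lam k) (φ k) ω := by
  rcases (h.nonneg k).eq_or_lt with hk | hk
  · have hzero : coeffOp (centered v) (φ k) = 0 := by
      rw [← norm_eq_zero, ← sq_eq_zero_iff, h.norm_coeffOp_sq, ← hk]
    filter_upwards [coeffOp_ae_eq (centered v) (φ k), Lp.coeFn_zero ℝ 2 P] with ω hω hω0
    rw [← hω, hzero, hω0, ← hk, Real.sqrt_zero, zero_mul, Pi.zero_apply]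
  · filter_upwards [klCoeff_ae_eq v (lam k) (φ k)] with ω hω
    rw [hω, mul_inv_cancel_left₀ (Real.sqrt_pos.2 hk).ne']

theorem tendsto_eLpNorm_klExpansion :
    Tendsto (fun s : Finset ℕ => eLpNorm (fun ω => v ω - (meanField v +
      ∑ k ∈ s, (√(lam k) * klCoeff v (lam k) (φ k) ω) • φ k)) 2 P) atTop (𝓝 0) := by
  have hterm : ∀ k, (InnerProductSpace.rankOne ℝ (φ k) (φ k)).compLp (centered v) =ᵐ[P]
      fun ω => (√(lam k) * klCoeff v (lam k) (φ k) ω) • φ k := fun k => by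
    filter_upwards [(InnerProductSpace.rankOne ℝ (φ k) (φ k)).coeFn_compLp (centered v),
      h.inner_centered_ae_eq k] with ω hω hcoeff
    rw [hω, InnerProductSpace.rankOne_apply, hcoeff]
  refine (tendsto_eLpNorm_sub_sum_of_hasSum h.hasSum_rankOne_compLp hterm).congr fun s => ?_
  refine eLpNorm_congr_ae ?_
  filter_upwards [centered_ae_eq v] with ω hω
  rw [hω, sub_sub]
  rfl

end IsEigensystem

end KarhunenLoeve

theorem not_finiteDimensional_L2Field {d q : ℕ} (hd : 0 < d) (hq : 0 < q)
    {U : Set (EuclideanSpace ℝ (Fin d))} (hU : IsOpen U) (hUne : U.Nonempty) :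
    ¬ FiniteDimensional ℝ (L2Field U q) := by
  have : Nonempty (Fin d) := ⟨⟨0, hd⟩⟩
  have : Nonempty (Fin q) := ⟨⟨0, hq⟩⟩
  have : ∀ x : EuclideanSpace ℝ (Fin d), NeBot (𝓝[≠] x) := Module.punctured_nhds_neBot ℝ _
  exact not_finiteDimensional_Lp_restrict hU hUne

theorem mainTheorem1 {d q : ℕ} (hd : 0 < d) (hq : 0 < q)
    {Ω : Type*} [MeasurableSpace Ω] (P : Measure Ω) [IsProbabilityMeasure P]
    (U : Set (EuclideanSpace ℝ (Fin d))) (hU : IsOpen U) (hUne : U.Nonempty)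
    (v : RandomField P U q) :
    (∃ V, IsPointwiseVersion v V) ∧
    ∀ V, IsPointwiseVersion v V →
      -- the mean, the covariance function and the covariance operator are well defined
      (∀ᵐ x ∂(volume.restrict U), MemLp (V x) 2 P ∧ meanField v x = ∫ ω, V x ω ∂P) ∧
      (∀ i j, MemLp (fun z : EuclideanSpace ℝ (Fin d) × EuclideanSpace ℝ (Fin d) =>
        covMatrix P V z.1 z.2 i j) 2 ((volume.restrict U).prod (volume.restrict U))) ∧
      (∀ u : L2Field U q, MemLp (covOp P U V u) 2 (volume.restrict U)) ∧
      -- the eigenpairs exist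
      (∃ (lam : ℕ → ℝ) (φ : ℕ → L2Field U q), IsCovEigensystem P V lam φ) ∧
      ∀ (lam : ℕ → ℝ) (φ : ℕ → L2Field U q), IsCovEigensystem P V lam φ →
        Summable lam ∧
        -- the coefficients
        (∀ k, MemLp (klCoeff v (lam k) (φ k)) 2 P) ∧
        (∀ k, 0 < lam k → ∫ ω, klCoeff v (lam k) (φ k) ω ∂P = 0) ∧
        (∀ k l, 0 < lam k → 0 < lam l →
          ∫ ω, klCoeff v (lam k) (φ k) ω * klCoeff v (lam l) (φ l) ω ∂P
            = if k = l then 1 else 0) ∧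
        -- the expansion, converging unconditionally in the Bochner space
        Tendsto (fun s : Finset ℕ => eLpNorm (fun ω => v ω - (meanField v +
            ∑ k ∈ s, (Real.sqrt (lam k) * klCoeff v (lam k) (φ k) ω) • φ k)) 2 P)
          atTop (𝓝 0) ∧
        -- optimality of the truncated expansion
        ∀ M : ℕ,
          IsLeast {e : ℝ | ∃ H : Submodule ℝ (L2Field U q), FiniteDimensional ℝ H ∧
              Module.finrank ℝ H = M ∧ e = projError (v - Lp.const 2 P (meanField v)) H}
            (Real.sqrt (∑' k, lam (M + k))) ∧
          projError (v - Lp.const 2 P (meanField v)) (Submodule.span ℝ (φ '' Set.Iio M))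
            = Real.sqrt (∑' k, lam (M + k)) ∧
          ∀ H : Submodule ℝ (L2Field U q), FiniteDimensional ℝ H → Module.finrank ℝ H = M →
            (projError (v - Lp.const 2 P (meanField v)) H = Real.sqrt (∑' k, lam (M + k)) ↔
              ∃ ψ : Fin M → L2Field U q, Orthonormal ℝ ψ ∧
                (∀ i : Fin M, CovEigen P V (lam i) (ψ i)) ∧
                H = Submodule.span ℝ (Set.range ψ)) ∧
            ((∀ i < M, lam M < lam i) →
              projError (v - Lp.const 2 P (meanField v)) H = Real.sqrt (∑' k, lam (M + k)) →
              H = Submodule.span ℝ (φ '' Set.Iio M)) := by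
  refine ⟨exists_isPointwiseVersion v, fun V hV => ⟨?_, hV.memLp_covMatrix, hV.memLp_covOp, ?_, ?_⟩⟩
  · exact hV.ae_memLp.and hV.meanField_ae_eq
  · simp only [hV.isCovEigensystem_iff]
    exact exists_isEigensystem (isPositive_uncenteredCovOp _) (isCompactOperator_uncenteredCovOp _)
      (not_finiteDimensional_L2Field hd hq hU hUne)
  intro lam φ hsys
  have h := (hV.isCovEigensystem_iff lam φ).1 hsys
  have hcentered : v - Lp.const 2 P (meanField v) = centered v := rfl
  simp only [hV.covEigen_iff, hcentered]
  exact ⟨h.hasSum_eigenvalues.summable, fun k => memLp_klCoeff v _ _,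
    fun k _ => integral_klCoeff v _ _, fun k l hk _ => h.integral_klCoeff_mul_klCoeff hk,
    h.tendsto_eLpNorm_klExpansion, fun M => ⟨h.isLeast_projError M, h.projError_span_image_Iio M,
      fun H _ hM => ⟨h.projError_eq_iff hM, h.eq_span_of_projError_eq hM⟩⟩⟩
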